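/- Let $S_n$ be the set of permutations of $\{1,\dots,n\}$. A crossing of $\sigma\in S_n$ is a pair of indices $(i,j)$ with $i<j<\sigma(i)<\sigma(j)$ or $\sigma(i)<\sigma(j)\le i<j$; a nesting of $\sigma$ is a pair $(i,j)$ with $i<j<\sigma(j)<\sigma(i)$ or $\sigma(j)<\sigma(i)\le i<j$. Let $\mathrm{crs}(\sigma)$ and $\mathrm{nes}(\sigma)$ be the numbers of crossings and nestings of $\sigma$. For a pattern $\tau\in S_3$, let $S_n(\tau)$ be the set of $\sigma\in S_n$ that avoid $\tau$, i.e. for which there are no positions $i_1<i_2<i_3$ such that $\sigma(i_1),\sigma(i_2),\sigma(i_3)$ are in the same relative order as $\tau(1),\tau(2),\tau(3)$. For a tuple of statistics $(\mathrm{st}_1,\dots,\mathrm{st}_k)$, call $\tau,\tau'\in S_3$ $(\mathrm{st}_1,\dots,\mathrm{st}_k)$-Wilf-equivalent if for every $n$ $$\sum_{\sigma\in S_n(\tau)}x_1^{\mathrm{st}_1(\sigma)}\cdots x_k^{\mathrm{st}_k(\sigma)}=\sum_{\sigma\in S_n(\tau')}x_1^{\mathrm{st}_1(\sigma)}\cdots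 x_k^{\mathrm{st}_k(\sigma)},$$ and let $[\tau]_{\mathrm{st}_1,\dots,\mathrm{st}_k}$ be the class of $\tau$ in $S_3$. **Theorem.** For the patterns in $S_3$: 1. the $\mathrm{nes}$-Wilf-equivalence classes are $\{123\}$, $\{321\}$, $[132]_{\mathrm{nes}}=\{132,213\}$ and $[231]_{\mathrm{nes}}=\{231,312\}$; 2. the $\mathrm{crs}$-Wilf-equivalence classes are $\{123\}$, $\{312\}$, $\{231\}$ and $[132]_{\mathrm{crs}}=\{132,213,321\}$; 3. the $(\mathrm{crs},\mathrm{nes})$-Wilf-equivalence classes are $\{123\}$, $\{321\}$, $\{312\}$, $\{231\}$ and $[132]_{\mathrm{crs},\mathrm{nes}}=\{132,213\}$. -/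

import Mathlib

namespace PermPattern

/-- `S_n`, the set of all permutations of `n` linearly ordered letters. Positions and letters are
`0, …, n - 1` instead of `1, …, n`; all notions below only compare positions and letters with one
another, so that this common shift changes nothing. -/
abbrev S (n : ℕ) : Type := Equiv.Perm (Fin n)

/-- A permutation of any length, regarded as a pattern. -/
abbrev Pattern : Type := Σ k : ℕ, S k

/-- `σ` contains an occurrence of `τ`: there are positions `i_1 < ⋯ < i_k` such that the letters
`σ(i_1), …, σ(i_k)` are in the same relative order as `τ(1), …, τ(k)`. -/
def Contains {k n : ℕ} (τ : S k) (σ : S n) : Prop :=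
  ∃ i : Fin k → Fin n, StrictMono i ∧ ∀ a b : Fin k, σ (i a) < σ (i b) ↔ τ a < τ b

open Classical in
/-- `S_n(T)`: the permutations of length `n` that avoid every pattern in `T`. -/
noncomputable def avoiders (T : Set Pattern) (n : ℕ) : Finset (S n) :=
  Finset.univ.filter fun σ => ∀ τ ∈ T, ¬ Contains τ.2 σ

/-- A permutation statistic. -/
abbrev Statistic : Type := ∀ n : ℕ, S n → ℕ

/-- `(i, j)` is a crossing of `σ`. -/
def IsCrossing {n : ℕ} (σ : S n) (i j : Fin n) : Prop :=
  (i < j ∧ j < σ i ∧ σ i < σ j) ∨ (σ i < σ j ∧ σ j ≤ i ∧ i < j)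

/-- `(i, j)` is a nesting of `σ`. -/
def IsNesting {n : ℕ} (σ : S n) (i j : Fin n) : Prop :=
  (i < j ∧ j < σ j ∧ σ j < σ i) ∨ (σ j < σ i ∧ σ i ≤ i ∧ i < j)

instance {n : ℕ} (σ : S n) (i j : Fin n) : Decidable (IsCrossing σ i j) := by
  unfold IsCrossing; infer_instance

instance {n : ℕ} (σ : S n) (i j : Fin n) : Decidable (IsNesting σ i j) := by
  unfold IsNesting; infer_instance

/-- The number of crossings. -/
def crs : Statistic := fun n σ =>
  (Finset.univ.filter fun p : Fin n × Fin n => IsCrossing σ p.1 p.2).card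

/-- The number of nestings. -/
def nes : Statistic := fun n σ =>
  (Finset.univ.filter fun p : Fin n × Fin n => IsNesting σ p.1 p.2).card

/-- The generating polynomial `∑_{σ ∈ S_n(T)} x_1^{st_1(σ)} ⋯ x_k^{st_k(σ)}`. -/
noncomputable def genPoly {k : ℕ} (st : Fin k → Statistic) (T : Set Pattern) (n : ℕ) :
    MvPolynomial (Fin k) ℤ :=
  ∑ σ ∈ avoiders T n, ∏ m : Fin k, (MvPolynomial.X m) ^ (st m n σ)

/-- `T` and `T'` are `(st_1, …, st_k)`-Wilf-equivalent. -/
def WilfEquiv {k : ℕ} (st : Fin k → Statistic) (T T' : Set Pattern) : Prop :=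
  ∀ n : ℕ, genPoly st T n = genPoly st T' n

/-- `(st_1, …, st_k)`-Wilf-equivalence of single patterns of length `l`. -/
def wilfSetoid {k : ℕ} (st : Fin k → Statistic) (l : ℕ) : Setoid (S l) where
  r τ τ' := WilfEquiv st {⟨l, τ⟩} {⟨l, τ'⟩}
  iseqv := ⟨fun _ _ => rfl, fun h n => (h n).symm, fun h h' n => (h n).trans (h' n)⟩

/-- The set of all `(st_1, …, st_k)`-Wilf-equivalence classes of single patterns of length `l`. -/
def wilfClasses {k : ℕ} (st : Fin k → Statistic) (l : ℕ) : Set (Set (S l)) :=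
  (wilfSetoid st l).classes

/-- The class `[τ]_{st_1, …, st_k}` of `τ` among the single patterns of the same length. -/
def wilfClass {k l : ℕ} (st : Fin k → Statistic) (τ : S l) : Set (S l) :=
  {τ' | WilfEquiv st {⟨l, τ'⟩} {⟨l, τ⟩}}

/-! The six permutations of length three: the first vector is the word of the permutation (with
letters lowered by one), the second is the word of the inverse permutation. -/

/-- `123` -/
def p123 : S 3 := ⟨![0, 1, 2], ![0, 1, 2], by decide, by decide⟩
/-- `132` -/
def p132 : S 3 := ⟨![0, 2, 1], ![0, 2, 1], by decide, by decide⟩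
/-- `213` -/
def p213 : S 3 := ⟨![1, 0, 2], ![1, 0, 2], by decide, by decide⟩
/-- `231` -/
def p231 : S 3 := ⟨![1, 2, 0], ![2, 0, 1], by decide, by decide⟩
/-- `312` -/
def p312 : S 3 := ⟨![2, 0, 1], ![1, 2, 0], by decide, by decide⟩
/-- `321` -/
def p321 : S 3 := ⟨![2, 1, 0], ![2, 1, 0], by decide, by decide⟩

end PermPattern

open PermPattern

/-!
The reverse complement of the inverse preserves crossings and nestings and exchanges 132 and 213,
and inversion preserves nestings and exchanges 231 and 312. All the patterns that are to be told
apart are so by the permutations of length four. What remains is that crossings have the same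
distribution on the permutations that avoid 132 and on those that avoid 321; both generating
functions are sums over the same weighted lattice paths.

In a permutation avoiding 321, the crossings of the inverse can be counted letter by letter as an
area. Appending a last letter is then a linear operator, in the number of letters that may be
appended; the elementary symmetric polynomials at `1, q, …, q ^ (b - 1)`, as functions of `b`, are
a basis in which it is the transfer matrix of the lattice paths.

Splitting permutations avoiding 132 at their greatest letter turns them into noncrossing matchings
of `2 n` consecutive integers, in which an arc between `x` and `y` has weight `s ^ ||x| - |y||`
where `q = s ^ 2`. In a symmetric interval the integers of greatest absolute value are the
outermost ones, so that the weight of an arc at an end is a product over its two ends. Taking the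
matchings apart from the outside inwards, and keeping count of the arcs that are cut open, again
gives the lattice paths.
-/

namespace PermPattern

section Permutations

variable {k n : ℕ}

/-! ### Pattern containment and its symmetries -/

theorem contains_iff_exists_strictMono {τ : S k} {σ : S n} :
    Contains τ σ ↔ ∃ i : Fin k → Fin n, StrictMono i ∧ StrictMono (σ ∘ i ∘ τ.symm) := by
  refine exists_congr fun i => and_congr_right fun _ => ⟨fun h a b hab => ?_, fun h a b => ?_⟩
  · simpa [h] using hab
  · simpa using h.lt_iff_lt (a := τ a) (b := τ b)

theorem contains_inv_iff {τ : S k} {σ : S n} : Contains τ⁻¹ σ⁻¹ ↔ Contains τ σ := by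
  have contains_inv {τ : S k} {σ : S n} (h : Contains τ σ) : Contains τ⁻¹ σ⁻¹ := by
    obtain ⟨i, hi, hσi⟩ := contains_iff_exists_strictMono.1 h
    refine contains_iff_exists_strictMono.2 ⟨σ ∘ i ∘ τ.symm, hσi, ?_⟩
    convert hi using 1
    ext a
    simp [Equiv.Perm.inv_def]
  exact ⟨fun h => by simpa only [inv_inv] using contains_inv h, contains_inv⟩

/-- The reverse complement of the inverse: the reflection of the permutation matrix in the
antidiagonal. -/
def reverseComplementInverse : S n ≃ S n :=
  (Equiv.inv (S n)).trans Fin.revPerm.permCongr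

theorem reverseComplementInverse_apply (σ : S n) (i : Fin n) :
    reverseComplementInverse σ i = (σ.symm i.rev).rev := rfl

theorem reverseComplementInverse_symm_apply (σ : S n) (i : Fin n) :
    (reverseComplementInverse σ).symm i = (σ i.rev).rev := rfl

theorem reverseComplementInverse_rev (σ : S n) (i : Fin n) :
    reverseComplementInverse σ (σ i).rev = i.rev := by
  simp [reverseComplementInverse_apply]

theorem reverseComplementInverse_involutive :
    Function.Involutive (reverseComplementInverse : S n → S n) := fun σ =>
  Equiv.ext fun i => by
    simpa [reverseComplementInverse_rev] using
      reverseComplementInverse_rev (reverseComplementInverse σ) (σ i).rev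

theorem contains_reverseComplementInverse_iff {τ : S k} {σ : S n} :
    Contains (reverseComplementInverse τ) (reverseComplementInverse σ) ↔ Contains τ σ := by
  have contains_rci {τ : S k} {σ : S n} (h : Contains τ σ) :
      Contains (reverseComplementInverse τ) (reverseComplementInverse σ) := by
    obtain ⟨i, hi, hσi⟩ := contains_iff_exists_strictMono.1 h
    refine contains_iff_exists_strictMono.2
      ⟨Fin.rev ∘ (σ ∘ i ∘ τ.symm) ∘ Fin.rev, Fin.rev_strictAnti.comp
        (hσi.comp_strictAnti Fin.rev_strictAnti), ?_⟩
    convert Fin.rev_strictAnti.comp (hi.comp_strictAnti Fin.rev_strictAnti) using 1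
    ext a
    simp [reverseComplementInverse_rev, reverseComplementInverse_symm_apply]
  exact ⟨fun h => by simpa only [reverseComplementInverse_involutive _] using contains_rci h,
    contains_rci⟩

theorem contains_three_iff {τ : S 3} {σ : S n} :
    Contains τ σ ↔ ∃ a b c, a < b ∧ b < c ∧
      σ (![a, b, c] (τ.symm 0)) < σ (![a, b, c] (τ.symm 1)) ∧
      σ (![a, b, c] (τ.symm 1)) < σ (![a, b, c] (τ.symm 2)) := by
  have strictMono_iff (i : Fin 3 → Fin n) : StrictMono i ↔ i 0 < i 1 ∧ i 1 < i 2 := by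
    rw [Fin.strictMono_iff_lt_succ, Fin.forall_fin_two]
    rfl
  simp only [contains_iff_exists_strictMono, strictMono_iff, Fin.exists_fin_succ_pi,
    Fin.exists_fin_zero_pi, and_assoc]
  rfl

instance (τ : S 3) (σ : S n) : Decidable (Contains τ σ) :=
  decidable_of_iff' _ contains_three_iff

theorem contains_p132_iff {σ : S n} :
    Contains p132 σ ↔ ∃ a b c, a < b ∧ b < c ∧ σ a < σ c ∧ σ c < σ b :=
  contains_three_iff

theorem contains_p321_iff {σ : S n} :
    Contains p321 σ ↔ ∃ a b c, a < b ∧ b < c ∧ σ c < σ b ∧ σ b < σ a :=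
  contains_three_iff

theorem mem_avoiders_singleton {τ : S k} {σ : S n} :
    σ ∈ avoiders {⟨k, τ⟩} n ↔ ¬ Contains τ σ := by
  simp [avoiders]

theorem wilfEquiv_of_equiv {m : ℕ} {st : Fin m → Statistic} {τ τ' : S k} (φ : ∀ n, S n ≃ S n)
    (hφ : ∀ n (σ : S n), Contains τ' (φ n σ) ↔ Contains τ σ)
    (hst : ∀ n (σ : S n) i, st i n (φ n σ) = st i n σ) :
    WilfEquiv st {⟨k, τ⟩} {⟨k, τ'⟩} := fun n =>
  Finset.sum_equiv (φ n) (fun σ => by simp only [mem_avoiders_singleton, hφ])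
    fun σ _ => by simp only [hst]

/-! ### Crossings and nestings under the symmetries -/

theorem crs_reverseComplementInverse (σ : S n) :
    crs n (reverseComplementInverse σ) = crs n σ := by
  symm
  refine Finset.card_equiv ((Equiv.prodComm _ _).trans
    ((σ.trans Fin.revPerm).prodCongr (σ.trans Fin.revPerm))) fun ⟨i, j⟩ => ?_
  rw [Finset.mem_filter_univ, Finset.mem_filter_univ]
  simp only [IsCrossing, Equiv.trans_apply, Equiv.prodComm_apply,
    Prod.swap_prod_mk, Equiv.prodCongr_apply, Prod.map_apply, Fin.revPerm_apply,
    reverseComplementInverse_rev, Fin.rev_lt_rev, Fin.rev_le_rev]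
  tauto

theorem nes_reverseComplementInverse (σ : S n) :
    nes n (reverseComplementInverse σ) = nes n σ := by
  symm
  refine Finset.card_equiv ((σ.trans Fin.revPerm).prodCongr (σ.trans Fin.revPerm))
    fun ⟨i, j⟩ => ?_
  rw [Finset.mem_filter_univ, Finset.mem_filter_univ]
  simp only [IsNesting, Equiv.trans_apply, Equiv.prodCongr_apply,
    Prod.map_apply, Fin.revPerm_apply, reverseComplementInverse_rev, Fin.rev_lt_rev,
    Fin.rev_le_rev]
  tauto

theorem card_leaving_eq_card_entering {α : Type*} [Fintype α] (σ : Equiv.Perm α) (P : α → Prop)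
    [DecidablePred P] :
    (Finset.univ.filter fun x => P x ∧ ¬ P (σ x)).card =
      (Finset.univ.filter fun x => ¬ P x ∧ P (σ x)).card := by
  have card_comp : (Finset.univ.filter fun x => P (σ x)).card = (Finset.univ.filter P).card :=
    Finset.card_equiv σ (by simp)
  have split_source := Finset.card_filter_add_card_filter_not (s := Finset.univ.filter P)
    fun x => P (σ x)
  have split_target := Finset.card_filter_add_card_filter_not
    (s := Finset.univ.filter fun x => P (σ x)) P
  simp only [Finset.filter_filter, and_comm (a := P (σ _))] at split_source split_target
  omega

theorem card_jumps_over_fixed_point (σ : S n) {f : Fin n} (hf : σ f = f) :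
    (Finset.univ.filter fun i => i < f ∧ f < σ i).card =
      (Finset.univ.filter fun j => f < j ∧ σ j < f).card := by
  have fixed_iff (x : Fin n) : σ x = f ↔ x = f := by rw [← σ.apply_eq_iff_eq (x := x), hf]
  convert card_leaving_eq_card_entering σ (· < f) using 3 <;> grind

theorem nes_eq_add (σ : S n) : nes n σ =
    (Finset.univ.filter fun p : Fin n × Fin n => p.1 < p.2 ∧ p.2 < σ p.2 ∧ σ p.2 < σ p.1).card +
    (Finset.univ.filter fun p : Fin n × Fin n => σ p.2 < σ p.1 ∧ σ p.1 < p.1 ∧ p.1 < p.2).card +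
    ∑ f with σ f = f, (Finset.univ.filter fun j => f < j ∧ σ j < f).card := by
  simp only [nes, Finset.sum_filter, Finset.card_filter, Fintype.sum_prod_type,
    ← Finset.sum_add_distrib]
  refine Finset.sum_congr rfl fun i _ => ?_
  by_cases hi : σ i = i
  · simp only [IsNesting, hi, if_true, ← Finset.sum_add_distrib]
    exact Finset.sum_congr rfl fun j _ => by grind
  · simp only [IsNesting, hi, if_false, add_zero]
    exact Finset.sum_congr rfl fun j _ => by grind

theorem nes_inv (σ : S n) : nes n σ⁻¹ = nes n σ := by
  have upper_inv (σ : S n) :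
      (Finset.univ.filter fun p : Fin n × Fin n =>
        p.1 < p.2 ∧ p.2 < σ⁻¹ p.2 ∧ σ⁻¹ p.2 < σ⁻¹ p.1).card =
      (Finset.univ.filter fun p : Fin n × Fin n =>
        σ p.2 < σ p.1 ∧ σ p.1 < p.1 ∧ p.1 < p.2).card :=
    Finset.card_equiv ((Equiv.prodComm _ _).trans (σ⁻¹.prodCongr σ⁻¹)) fun ⟨i, j⟩ => by simp
  have fixed_inv (f : Fin n) : σ⁻¹ f = f ↔ σ f = f := by rw [Equiv.Perm.inv_eq_iff_eq, eq_comm]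
  have over_inv (f : Fin n) :
      (Finset.univ.filter fun j => f < j ∧ σ⁻¹ j < f).card =
        (Finset.univ.filter fun i => i < f ∧ f < σ i).card :=
    Finset.card_equiv σ⁻¹ fun j => by simp [and_comm]
  have upper_eq := upper_inv σ
  have lower_eq := upper_inv σ⁻¹
  simp only [inv_inv] at lower_eq
  rw [nes_eq_add, nes_eq_add, upper_eq, ← lower_eq, add_comm (Finset.card _)]
  congr 1
  simp only [fixed_inv, over_inv]
  exact Finset.sum_congr rfl fun f hf =>
    card_jumps_over_fixed_point σ (Finset.mem_filter.1 hf).2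

theorem wilfEquiv_crs_nes_reverseComplementInverse (τ : S k) :
    WilfEquiv ![crs, nes] {⟨k, τ⟩} {⟨k, reverseComplementInverse τ⟩} :=
  wilfEquiv_of_equiv (fun _ => reverseComplementInverse)
    (fun _ _ => contains_reverseComplementInverse_iff) fun _ σ i => by
      fin_cases i
      exacts [crs_reverseComplementInverse σ, nes_reverseComplementInverse σ]

theorem wilfEquiv_nes_inv (τ : S k) : WilfEquiv ![nes] {⟨k, τ⟩} {⟨k, τ⁻¹⟩} :=
  wilfEquiv_of_equiv (fun n => Equiv.inv (S n)) (fun _ _ => contains_inv_iff) fun _ σ i => by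
    fin_cases i
    exact nes_inv σ

/-! ### Crossings of 321-avoiding permutations -/

theorem card_jumps_over_gap (σ : S n) (k : Fin n) :
    (Finset.univ.filter fun i => i ≤ k ∧ k < σ i).card =
      (Finset.univ.filter fun j => k < j ∧ σ j ≤ k).card := by
  simpa only [not_le] using card_leaving_eq_card_entering σ (· ≤ k)

theorem exists_jump_over_gap (σ : S n) (k : Fin n) :
    (∃ i, i ≤ k ∧ k < σ i) ↔ ∃ j, k < j ∧ σ j ≤ k := by
  have card_pos_iff (P : Fin n → Prop) [DecidablePred P] :
      (∃ i, P i) ↔ 0 < (Finset.univ.filter P).card := by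
    simp [Finset.card_pos, Finset.Nonempty]
  rw [card_pos_iff, card_pos_iff, card_jumps_over_gap]

theorem exists_inversion_of_apply_lt {σ : S n} {k : Fin n} (hk : σ k < k) :
    ∃ i < k, σ k < σ i := by
  obtain ⟨i, hi, hσi⟩ := (exists_jump_over_gap σ (σ k)).2 ⟨k, hk, le_rfl⟩
  exact ⟨i, hi.trans_lt hk, hσi⟩

section AvoidingP321

variable {σ : S n} {i j k : Fin n}

theorem apply_lt_apply_of_le_apply (hσ : ¬ Contains p321 σ) (hik : i < k) (hk : k ≤ σ k) :
    σ i < σ k := by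
  by_contra! hki
  have hki : σ k < σ i := hki.lt_of_ne (σ.injective.ne hik.ne')
  obtain ⟨j, hkj, hσj⟩ := (exists_jump_over_gap σ k).1 ⟨i, hik.le, hk.trans_lt hki⟩
  have hjk : σ j < σ k := (hσj.trans hk).lt_of_ne (σ.injective.ne hkj.ne')
  exact hσ (contains_p321_iff.2 ⟨i, k, j, hik, hkj, hjk, hki⟩)

theorem apply_lt_apply_of_apply_lt (hσ : ¬ Contains p321 σ) (hk : σ k < k) (hkj : k < j) :
    σ k < σ j := by
  by_contra! hjk
  obtain ⟨i, hik, hki⟩ := exists_inversion_of_apply_lt hk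
  exact hσ (contains_p321_iff.2
    ⟨i, k, j, hik, hkj, hjk.lt_of_ne (σ.injective.ne hkj.ne'), hki⟩)

end AvoidingP321

theorem crs_eq_sum (σ : S n) : crs n σ =
    ∑ k, ((Finset.univ.filter fun i => i < k ∧ k < σ i ∧ σ i < σ k).card +
      (Finset.univ.filter fun j => σ k < σ j ∧ σ j ≤ k ∧ k < j).card) := by
  calc crs n σ = ∑ p : Fin n × Fin n,
        ((if p.1 < p.2 ∧ p.2 < σ p.1 ∧ σ p.1 < σ p.2 then 1 else 0) +
          if σ p.1 < σ p.2 ∧ σ p.2 ≤ p.1 ∧ p.1 < p.2 then 1 else 0) := by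
        rw [crs, Finset.card_filter]
        exact Finset.sum_congr rfl fun p _ => by unfold IsCrossing; grind
    _ = _ := by
        rw [Finset.sum_add_distrib, Fintype.sum_prod_type_right, Fintype.sum_prod_type,
          ← Finset.sum_add_distrib]
        simp only [Finset.card_filter]

theorem crs_of_not_contains_p321 {σ : S n} (hσ : ¬ Contains p321 σ) :
    crs n σ = ∑ k, (Finset.univ.filter fun i => i < k ∧ k < σ i).card := by
  rw [crs_eq_sum]
  refine Finset.sum_congr rfl fun k _ => ?_
  rcases le_or_gt k (σ k) with hk | hk
  · have no_right (j : Fin n) : ¬ (σ k < σ j ∧ σ j ≤ k ∧ k < j) := by grind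
    have left_iff (i : Fin n) : i < k ∧ k < σ i ∧ σ i < σ k ↔ i < k ∧ k < σ i := by
      have := apply_lt_apply_of_le_apply hσ (i := i) (k := k)
      tauto
    simp [no_right, left_iff]
  · have no_left (i : Fin n) : ¬ (i < k ∧ k < σ i ∧ σ i < σ k) := by grind
    have right_iff (j : Fin n) : σ k < σ j ∧ σ j ≤ k ∧ k < j ↔ k < j ∧ σ j ≤ k := by
      have := apply_lt_apply_of_apply_lt hσ (k := k) (j := j)
      tauto
    have left_iff (i : Fin n) : i < k ∧ k < σ i ↔ i ≤ k ∧ k < σ i := by grind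
    simp [no_left, right_iff, left_iff, card_jumps_over_gap]

/-- The number of pairs `(k, j)` with `σ j < k < j`. -/
def lowerArea (σ : S n) : ℕ := ∑ j : Fin n, (j.val - (σ j).val - 1)

theorem crs_inv_of_not_contains_p321 {σ : S n} (hσ : ¬ Contains p321 σ) :
    crs n σ⁻¹ = lowerArea σ := by
  rw [← contains_inv_iff] at hσ
  simp only [crs_of_not_contains_p321 hσ, lowerArea, ← Fin.card_Ioo, ← Finset.card_sigma]
  refine Finset.card_bij' (fun x _ => ⟨σ⁻¹ x.2, x.1⟩) (fun x _ => ⟨x.2, σ x.1⟩) ?_ ?_ ?_ ?_ <;>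
    simp

/-! ### Appending a last letter -/

/-- The permutation `σ` with a last letter `v` appended; the letters of `σ` from `v` on go up
by one. -/
def appendLetter (σ : S n) (v : Fin (n + 1)) : S (n + 1) :=
  (finSuccEquivLast.trans σ.optionCongr).trans (finSuccEquiv' v).symm

theorem appendLetter_castSucc (σ : S n) (v : Fin (n + 1)) (i : Fin n) :
    appendLetter σ v i.castSucc = v.succAbove (σ i) := by
  simp [appendLetter]

theorem appendLetter_last (σ : S n) (v : Fin (n + 1)) :
    appendLetter σ v (Fin.last n) = v := by
  simp [appendLetter]

theorem appendLetter_bijective :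
    Function.Bijective fun x : S n × Fin (n + 1) => appendLetter x.1 x.2 := by
  rw [Fintype.bijective_iff_injective_and_card]
  constructor
  · rintro ⟨σ, v⟩ ⟨τ, w⟩ (h : appendLetter σ v = appendLetter τ w)
    obtain rfl : v = w := by rw [← appendLetter_last σ v, h, appendLetter_last]
    congr 1
    ext i
    have apply_eq := appendLetter_castSucc σ v i
    rw [h, appendLetter_castSucc] at apply_eq
    rw [Fin.succAbove_right_injective apply_eq]
  · simp [Fintype.card_perm, Nat.factorial_succ, mul_comm]

/-- The least `c` such that every letter `σ b` of an inversion `a < b`, `σ b < σ a` is less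
than `c`. -/
def inversionBound (σ : S n) : ℕ :=
  (Finset.univ.filter fun p : Fin n × Fin n => p.1 < p.2 ∧ σ p.2 < σ p.1).sup fun p =>
    (σ p.2).val + 1

theorem lt_inversionBound_iff {σ : S n} {x : ℕ} :
    x < inversionBound σ ↔ ∃ a b, a < b ∧ σ b < σ a ∧ x ≤ σ b := by
  simp [inversionBound, Finset.lt_sup_iff, and_assoc]

theorem inversionBound_le (σ : S n) : inversionBound σ ≤ n := by
  by_contra! h
  obtain ⟨a, b, -, -, h⟩ := lt_inversionBound_iff.1 h
  omega

theorem contains_p321_appendLetter_iff {σ : S n} {v : Fin (n + 1)} :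
    Contains p321 (appendLetter σ v) ↔ Contains p321 σ ∨ v.val < inversionBound σ := by
  simp only [contains_p321_iff, lt_inversionBound_iff]
  constructor
  · rintro ⟨a, b, c, hab, hbc, hcb, hba⟩
    obtain ⟨b, rfl⟩ := Fin.exists_castSucc_eq.2 (hbc.trans_le (Fin.le_last c)).ne
    obtain ⟨a, rfl⟩ := Fin.exists_castSucc_eq.2 (hab.trans (Fin.castSucc_lt_last b)).ne
    simp only [appendLetter_castSucc, Fin.succAbove_lt_succAbove_iff] at hba hcb
    rcases c.eq_castSucc_or_eq_last with ⟨c, rfl⟩ | rfl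
    · rw [appendLetter_castSucc, Fin.succAbove_lt_succAbove_iff] at hcb
      exact Or.inl ⟨a, b, c, hab, hbc, hcb, hba⟩
    · rw [appendLetter_last, Fin.lt_succAbove_iff_le_castSucc] at hcb
      exact Or.inr ⟨a, b, hab, hba, hcb⟩
  · rintro (⟨a, b, c, hab, hbc, hcb, hba⟩ | ⟨a, b, hab, hba, hvb⟩)
    · refine ⟨a.castSucc, b.castSucc, c.castSucc, hab, hbc, ?_⟩
      simpa only [appendLetter_castSucc, Fin.succAbove_lt_succAbove_iff] using ⟨hcb, hba⟩
    · refine ⟨a.castSucc, b.castSucc, Fin.last n, hab, Fin.castSucc_lt_last b, ?_, ?_⟩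
      · rwa [appendLetter_castSucc, appendLetter_last, Fin.lt_succAbove_iff_le_castSucc]
      · simpa only [appendLetter_castSucc, Fin.succAbove_lt_succAbove_iff] using hba

section AvoidingAppend

variable {σ : S n} {v : Fin (n + 1)}

theorem val_appendLetter_castSucc_of_lt {i j : Fin n} (hv : inversionBound σ ≤ v) (hij : i < j)
    (hji : σ j < σ i) : (appendLetter σ v j.castSucc).val = σ j := by
  have hjv : σ j < inversionBound σ := lt_inversionBound_iff.2 ⟨i, j, hij, hji, le_rfl⟩
  rw [appendLetter_castSucc, Fin.succAbove_of_castSucc_lt, Fin.val_castSucc]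
  exact Fin.lt_def.2 (hjv.trans_le hv)

theorem lt_inversionBound_appendLetter_iff {x : ℕ} (hv : inversionBound σ ≤ v) :
    x < inversionBound (appendLetter σ v) ↔ x < inversionBound σ ∨ v.val < n ∧ x ≤ v := by
  simp only [lt_inversionBound_iff]
  constructor
  · rintro ⟨a, b, hab, hba, hxb⟩
    obtain ⟨a, rfl⟩ := Fin.exists_castSucc_eq.2 (hab.trans_le (Fin.le_last b)).ne
    rcases b.eq_castSucc_or_eq_last with ⟨b, rfl⟩ | rfl
    · rw [appendLetter_castSucc, appendLetter_castSucc, Fin.succAbove_lt_succAbove_iff] at hba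
      rw [val_appendLetter_castSucc_of_lt hv hab hba] at hxb
      exact Or.inl ⟨a, b, hab, hba, hxb⟩
    · rw [appendLetter_castSucc, appendLetter_last, Fin.lt_succAbove_iff_le_castSucc] at hba
      rw [appendLetter_last] at hxb
      exact Or.inr ⟨(Fin.le_def.1 hba).trans_lt (σ a).isLt, hxb⟩
  · rintro (⟨a, b, hab, hba, hxb⟩ | ⟨hvn, hxv⟩)
    · refine ⟨a.castSucc, b.castSucc, hab, ?_, ?_⟩
      · simpa only [appendLetter_castSucc, Fin.succAbove_lt_succAbove_iff] using hba
      · rwa [val_appendLetter_castSucc_of_lt hv hab hba]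
    · refine ⟨(σ.symm ⟨v, hvn⟩).castSucc, Fin.last n, Fin.castSucc_lt_last _, ?_, ?_⟩
      · simp [appendLetter_castSucc, appendLetter_last, Fin.lt_succAbove_iff_le_castSucc]
      · rwa [appendLetter_last]

theorem inversionBound_appendLetter (hv : inversionBound σ ≤ v) :
    inversionBound (appendLetter σ v) = if v.val < n then v.val + 1 else inversionBound σ := by
  refine eq_of_forall_lt_iff fun x => ?_
  rw [lt_inversionBound_appendLetter_iff hv]
  split_ifs <;> omega

theorem lowerArea_appendLetter (hv : inversionBound σ ≤ v) :
    lowerArea (appendLetter σ v) = lowerArea σ + (n - 1 - v) := by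
  rw [lowerArea, Fin.sum_univ_castSucc, lowerArea]
  congr 1
  · refine Finset.sum_congr rfl fun j _ => ?_
    rcases lt_or_ge (σ j) j with hj | hj
    · obtain ⟨i, hij, hji⟩ := exists_inversion_of_apply_lt hj
      rw [val_appendLetter_castSucc_of_lt hv hij hji, Fin.val_castSucc]
    · have le_appendLetter : (σ j).val ≤ appendLetter σ v j.castSucc := by
        rw [appendLetter_castSucc, Fin.succAbove]
        split_ifs <;> simp
      rw [Fin.le_def] at hj
      rw [Fin.val_castSucc]
      omega
  · rw [appendLetter_last, Fin.val_last, Nat.sub_right_comm]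

end AvoidingAppend

theorem sum_avoiders_p321_succ {M : Type*} [AddCommMonoid M] (g : S (n + 1) → M) :
    ∑ σ ∈ avoiders {⟨3, p321⟩} (n + 1), g σ =
      ∑ σ ∈ avoiders {⟨3, p321⟩} n, ∑ v with inversionBound σ ≤ v.val, g (appendLetter σ v) := by
  rw [Finset.sum_sigma']
  refine (Finset.sum_bij (fun x _ => appendLetter x.1 x.2) (fun x hx => ?_)
    (fun x _ y _ h => ?_) (fun σ hσ => ?_) fun _ _ => rfl).symm
  · simpa [mem_avoiders_singleton, contains_p321_appendLetter_iff] using hx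
  · obtain ⟨h₁, h₂⟩ := Prod.ext_iff.1
      (appendLetter_bijective.injective (a₁ := (x.1, x.2)) (a₂ := (y.1, y.2)) h)
    exact Sigma.ext h₁ (heq_of_eq h₂)
  · obtain ⟨⟨σ, v⟩, rfl⟩ := appendLetter_bijective.surjective σ
    refine ⟨⟨σ, v⟩, ?_, rfl⟩
    simpa [mem_avoiders_singleton, contains_p321_appendLetter_iff] using hσ

theorem sum_filter_le_eq_sum_range {M : Type*} [AddCommMonoid M] {c n : ℕ} (hc : c ≤ n)
    (g : ℕ → M) : ∑ v : Fin n with c ≤ v.val, g (n - 1 - v) = ∑ i ∈ Finset.range (n - c), g i := by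
  obtain ⟨b, rfl⟩ := Nat.exists_eq_add_of_le hc
  have lt_c (v : Fin c) : ¬ c ≤ v.val := v.isLt.not_ge
  have sub_add (v : Fin b) : c + b - 1 - (c + v.val) = b - 1 - v.val := by omega
  simp only [Finset.sum_filter, Fin.sum_univ_add, Fin.val_castAdd, Fin.val_natAdd, lt_c, if_false,
    Finset.sum_const_zero, zero_add, le_add_iff_nonneg_right, zero_le, if_true, sub_add,
    add_tsub_cancel_left]
  rw [Fin.sum_univ_eq_sum_range (fun v => g (b - 1 - v)), Finset.sum_range_reflect]

section AreaSum

variable {R : Type*} [CommSemiring R]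

/-- The generating function of the area of 321-avoiding permutations, with a weight on the number
of letters that can be appended without creating a pattern 321 (not counting the greatest). -/
noncomputable def areaSum (q : R) (n : ℕ) (f : ℕ → R) : R :=
  ∑ σ ∈ avoiders {⟨3, p321⟩} n, q ^ lowerArea σ * f (n - inversionBound σ)

theorem areaSum_succ (q : R) (n : ℕ) (f : ℕ → R) : areaSum q (n + 1) f =
    areaSum q n fun b => f (b + 1) + ∑ i ∈ Finset.range b, q ^ i * f (i + 1) := by
  rw [areaSum, sum_avoiders_p321_succ, areaSum]
  refine Finset.sum_congr rfl fun σ _ => ?_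
  have hσ := inversionBound_le σ
  have summand_eq (v : Fin (n + 1)) (hv : inversionBound σ ≤ v) :
      q ^ lowerArea (appendLetter σ v) * f (n + 1 - inversionBound (appendLetter σ v)) =
        q ^ lowerArea σ * if v.val < n then q ^ (n - 1 - v) * f (n - 1 - v + 1) else
          f (n - inversionBound σ + 1) := by
    rw [lowerArea_appendLetter hv, inversionBound_appendLetter hv, pow_add, mul_assoc]
    split_ifs with hvn
    · rw [show n + 1 - (v.val + 1) = n - 1 - v + 1 by omega]
    · rw [show n - 1 - v.val = 0 by omega, pow_zero, one_mul, Nat.sub_add_comm hσ]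
  rw [Finset.sum_congr rfl fun v hv => summand_eq v (Finset.mem_filter.1 hv).2,
    ← Finset.mul_sum, ← sum_filter_le_eq_sum_range hσ fun i => q ^ i * f (i + 1),
    Finset.sum_filter, Fin.sum_univ_castSucc, Finset.sum_filter, add_comm]
  simp [hσ]

theorem areaSum_add (q : R) (n : ℕ) (f g : ℕ → R) :
    areaSum q n (f + g) = areaSum q n f + areaSum q n g := by
  simp only [areaSum, Pi.add_apply, mul_add, Finset.sum_add_distrib]

theorem areaSum_smul (q : R) (n : ℕ) (c : R) (f : ℕ → R) :
    areaSum q n (c • f) = c * areaSum q n f := by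
  simp only [areaSum, Pi.smul_apply, smul_eq_mul, mul_left_comm _ c, Finset.mul_sum]

/-- Sum over the lattice paths from height `2 * g` to height `0` with `2 * n` steps `±1` that stay
nonnegative, where the first, third, … step has weight `q ^ ⌊h / 2⌋`, `h` being its lower end, and
the other steps have weight `1`. -/
def pathSum (q : R) : ℕ → ℕ → R
  | 0, 0 => 1
  | 0, _ + 1 => 0
  | n + 1, 0 => pathSum q n 0 + pathSum q n 1
  | n + 1, g + 1 => q ^ g * (pathSum q n g + pathSum q n (g + 1)) +
      q ^ (g + 1) * (pathSum q n (g + 1) + pathSum q n (g + 2))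

/-- The `g`-th elementary symmetric polynomial at `1, q, …, q ^ (b - 1)`. -/
def esymmGeom (q : R) : ℕ → ℕ → R
  | 0, _ => 1
  | _ + 1, 0 => 0
  | g + 1, b + 1 => esymmGeom q (g + 1) b + q ^ b * esymmGeom q g b

theorem sum_range_pow_mul_esymmGeom (q : R) (g b : ℕ) :
    ∑ i ∈ Finset.range b, q ^ i * esymmGeom q g i = esymmGeom q (g + 1) b := by
  induction b with
  | zero => rfl
  | succ b ih => rw [Finset.sum_range_succ, ih, esymmGeom]

theorem esymmGeom_succ_succ (q : R) (g b : ℕ) : esymmGeom q (g + 1) (b + 1) =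
    q ^ (g + 1) * esymmGeom q (g + 1) b + q ^ g * esymmGeom q g b := by
  induction b generalizing g with
  | zero => cases g <;> simp [esymmGeom]
  | succ b ih =>
    cases g with
    | zero =>
      calc esymmGeom q 1 (b + 2) = esymmGeom q 1 (b + 1) + q ^ (b + 1) * 1 := rfl
        _ = q * esymmGeom q 1 b + 1 + q ^ (b + 1) := by rw [ih]; simp [esymmGeom]
        _ = q ^ 1 * (esymmGeom q 1 b + q ^ b * 1) + q ^ 0 * 1 := by ring
        _ = q ^ 1 * esymmGeom q 1 (b + 1) + q ^ 0 * esymmGeom q 0 (b + 1) := by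
          simp only [esymmGeom]
    | succ g =>
      calc esymmGeom q (g + 2) (b + 2)
          = esymmGeom q (g + 2) (b + 1) + q ^ (b + 1) * esymmGeom q (g + 1) (b + 1) := rfl
        _ = q ^ (g + 2) * esymmGeom q (g + 2) b + q ^ (g + 1) * esymmGeom q (g + 1) b +
            q ^ (b + 1) * (q ^ (g + 1) * esymmGeom q (g + 1) b + q ^ g * esymmGeom q g b) := by
          rw [ih, ih]
        _ = q ^ (g + 2) * (esymmGeom q (g + 2) b + q ^ b * esymmGeom q (g + 1) b) +
            q ^ (g + 1) * (esymmGeom q (g + 1) b + q ^ b * esymmGeom q g b) := by ring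

theorem areaSum_esymmGeom (q : R) (n g : ℕ) :
    areaSum q n (esymmGeom q g) = pathSum q n g := by
  induction n generalizing g with
  | zero =>
    have avoiders_zero : avoiders {⟨3, p321⟩} 0 = {1} := by
      ext σ
      simp [mem_avoiders_singleton, Subsingleton.elim σ 1, contains_p321_iff]
    rw [areaSum, avoiders_zero, Finset.sum_singleton]
    cases g <;> simp [lowerArea, esymmGeom, pathSum]
  | succ n ih =>
    rw [areaSum_succ]
    cases g with
    | zero =>
      rw [pathSum, ← ih, ← ih, ← areaSum_add]
      congr with b
      simp only [Pi.add_apply, ← sum_range_pow_mul_esymmGeom, esymmGeom]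
    | succ g =>
      have sum_shift (b : ℕ) : ∑ i ∈ Finset.range b, q ^ i * esymmGeom q (g + 1) (i + 1) =
          q ^ (g + 1) * esymmGeom q (g + 2) b + q ^ g * esymmGeom q (g + 1) b := by
        rw [← sum_range_pow_mul_esymmGeom q (g + 1), ← sum_range_pow_mul_esymmGeom q g,
          Finset.mul_sum, Finset.mul_sum, ← Finset.sum_add_distrib]
        exact Finset.sum_congr rfl fun i _ => by rw [esymmGeom_succ_succ]; ring
      simp only [pathSum, ← ih, ← areaSum_add, ← areaSum_smul]
      congr with b
      simp only [Pi.add_apply, Pi.smul_apply, smul_eq_mul]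
      rw [sum_shift, esymmGeom_succ_succ]
      ring

theorem sum_pow_crs_p321 (q : R) (n : ℕ) :
    ∑ σ ∈ avoiders {⟨3, p321⟩} n, q ^ crs n σ = pathSum q n 0 := by
  rw [← areaSum_esymmGeom, areaSum]
  refine Finset.sum_equiv (Equiv.inv (S n)) (fun σ => ?_) fun σ hσ => ?_
  · simp only [mem_avoiders_singleton]
    exact contains_inv_iff.not.symm
  · rw [mem_avoiders_singleton, ← contains_inv_iff] at hσ
    simp [esymmGeom, ← crs_inv_of_not_contains_p321 hσ]

end AreaSum

end Permutations

/-! ### Weighted noncrossing matchings -/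

section Matching

variable {K : Type*} [CommRing K]

/-- The sum over the noncrossing perfect matchings of the integers in `(a, b]`, where an arc from
`x` to `y` has weight `w x y`. -/
noncomputable def matchingSum (w : ℤ → ℤ → K) (a b : ℤ) : K :=
  if a < b then
    ∑ x ∈ (Finset.Ioc a b).attach,
      w (a + 1) x * matchingSum w (a + 1) (x - 1) * matchingSum w x b
  else if a = b then 1 else 0
termination_by (b - a).toNat
decreasing_by
  all_goals have := Finset.mem_Ioc.1 x.2; omega

variable (w : ℤ → ℤ → K) (u : ℤ → K)

theorem matchingSum_of_lt {a b : ℤ} (h : b < a) : matchingSum w a b = 0 := by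
  rw [matchingSum, if_neg h.not_gt, if_neg h.ne']

theorem matchingSum_self (a : ℤ) : matchingSum w a a = 1 := by
  rw [matchingSum, if_neg (lt_irrefl a), if_pos rfl]

theorem matchingSum_eq_sum {a b : ℤ} (h : a < b) : matchingSum w a b =
    ∑ x ∈ Finset.Ioc a b, w (a + 1) x * matchingSum w (a + 1) (x - 1) * matchingSum w x b := by
  rw [matchingSum, if_pos h]
  exact Finset.sum_attach (Finset.Ioc a b) fun x =>
    w (a + 1) x * matchingSum w (a + 1) (x - 1) * matchingSum w x b

theorem matchingSum_eq_zero_of_odd {a b : ℤ} (h : Odd (b - a)) : matchingSum w a b = 0 := by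
  induction a, b using matchingSum.induct with
  | case1 a b hab ih ih' =>
    rw [matchingSum_eq_sum w hab]
    refine Finset.sum_eq_zero fun x hx => ?_
    rcases Int.even_or_odd (b - x) with hx' | hx'
    · rw [ih ⟨x, hx⟩ (by dsimp only; grind), mul_zero, zero_mul]
    · rw [ih' ⟨x, hx⟩ hx', mul_zero]
  | case2 b => simp at h
  | case3 a b hab hab' => exact matchingSum_of_lt w (by omega)

theorem matchingSum_eq_sum_antidiagonal (a : ℤ) (n : ℕ) :
    matchingSum w a (a + 2 * n + 2) = ∑ x ∈ Finset.HasAntidiagonal.antidiagonal n,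
      w (a + 1) (a + 2 * x.1 + 2) * matchingSum w (a + 1) (a + 2 * x.1 + 1) *
        matchingSum w (a + 2 * x.1 + 2) (a + 2 * n + 2) := by
  rw [matchingSum_eq_sum w (by omega)]
  symm
  refine Finset.sum_of_injOn (fun x : ℕ × ℕ => a + 2 * x.1 + 2) ?_ ?_ ?_ ?_
  · intro x hx y hy hxy
    simp only [Finset.mem_coe, Finset.HasAntidiagonal.mem_antidiagonal] at hx hy hxy
    ext <;> omega
  · intro x hx
    simp only [Finset.mem_coe, Finset.HasAntidiagonal.mem_antidiagonal, Finset.mem_Ioc] at hx ⊢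
    omega
  · intro x hx hx'
    rw [matchingSum_eq_zero_of_odd w, mul_zero, zero_mul]
    by_contra hodd
    obtain ⟨d, hd⟩ := Int.not_odd_iff_even.1 hodd
    rw [Finset.mem_Ioc] at hx
    refine hx' ⟨(d.toNat, n - d.toNat), ?_, ?_⟩
    · simp only [Finset.mem_coe, Finset.HasAntidiagonal.mem_antidiagonal]
      omega
    · dsimp only
      omega
  · intro x _
    congr 2
    rw [add_sub_assoc]
    rfl

/-- `matchingSum` as an element of the incidence algebra of `ℤ`: products concatenate matchings. -/
noncomputable def matchings : IncidenceAlgebra K ℤ :=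
  ⟨matchingSum w, fun _ _ h => matchingSum_of_lt w (not_le.1 h)⟩

/-- The matchings of `(a, b]` that contain an arc from `a + 1` to `b`. -/
noncomputable def archedMatchings : IncidenceAlgebra K ℤ :=
  ⟨fun a b => w (a + 1) b * matchingSum w (a + 1) (b - 1), fun a b h => by
    rw [matchingSum_of_lt w (by omega), mul_zero]⟩

/-- A single unmatched integer `x`, of weight `u x`. -/
def unmatched : IncidenceAlgebra K ℤ :=
  ⟨fun a b => if b = a + 1 then u b else 0, fun a b h => if_neg (by omega)⟩

/-- The noncrossing matchings that leave `k` integers unmatched, none of them below an arc. -/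
noncomputable def openMatchings (k : ℕ) : IncidenceAlgebra K ℤ :=
  matchings w * (unmatched u * matchings w) ^ k

theorem matchings_apply (a b : ℤ) : matchings w a b = matchingSum w a b := rfl

theorem archedMatchings_apply (a b : ℤ) :
    archedMatchings w a b = w (a + 1) b * matchingSum w (a + 1) (b - 1) := rfl

theorem archedMatchings_self (a : ℤ) : archedMatchings w a a = 0 := by
  rw [archedMatchings_apply, matchingSum_of_lt w (by omega), mul_zero]

theorem mul_unmatched_apply (f : IncidenceAlgebra K ℤ) (a b : ℤ) :
    (f * unmatched u) a b = f a (b - 1) * u b := by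
  rw [IncidenceAlgebra.mul_apply, Finset.sum_eq_single (b - 1)]
  · exact congrArg _ (if_pos (by ring))
  · exact fun x _ hx => mul_eq_zero_of_right _ (if_neg (by omega))
  · intro h
    rw [IncidenceAlgebra.apply_eq_zero_of_not_le (fun h' => h (Finset.mem_Icc.2 (by omega))) f,
      zero_mul]

theorem unmatched_mul_apply (f : IncidenceAlgebra K ℤ) (a b : ℤ) :
    (unmatched u * f) a b = u (a + 1) * f (a + 1) b := by
  rw [IncidenceAlgebra.mul_apply, Finset.sum_eq_single (a + 1)]
  · exact congrArg (· * _) (if_pos rfl)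
  · exact fun x _ hx => mul_eq_zero_of_left (if_neg hx) _
  · intro h
    rw [IncidenceAlgebra.apply_eq_zero_of_not_le (fun h' => h (Finset.mem_Icc.2 (by omega))) f,
      mul_zero]

theorem matchings_eq_one_add_arched_mul :
    matchings w = 1 + archedMatchings w * matchings w := by
  ext a b hab
  rw [IncidenceAlgebra.add_apply, IncidenceAlgebra.one_apply, IncidenceAlgebra.mul_apply,
    ← Finset.Ioc_insert_left hab, Finset.sum_insert Finset.left_notMem_Ioc,
    archedMatchings_self, zero_mul, zero_add]
  rcases hab.eq_or_lt with rfl | h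
  · simp [matchings_apply, matchingSum_self]
  · rw [if_neg h.ne, zero_add, matchings_apply, matchingSum_eq_sum w h]
    rfl

theorem eq_zero_of_eq_mul {f g : IncidenceAlgebra K ℤ} (hf : ∀ a, f a a = 0) (hg : g = f * g) :
    g = 0 := by
  have apply_eq_zero (d : ℕ) : ∀ a b : ℤ, b - a < d → g a b = 0 := by
    induction d with
    | zero => exact fun a b h => IncidenceAlgebra.apply_eq_zero_of_not_le (by omega) g
    | succ d ih =>
      intro a b h
      rw [hg, IncidenceAlgebra.mul_apply]
      refine Finset.sum_eq_zero fun x hx => ?_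
      rcases (Finset.mem_Icc.1 hx).1.eq_or_lt with rfl | hax
      · rw [hf, zero_mul]
      · rw [ih x b (by omega), mul_zero]
  ext a b hab
  exact apply_eq_zero (b - a + 1).toNat a b (by omega)

theorem matchings_eq_one_add_mul_arched :
    matchings w = 1 + matchings w * archedMatchings w := by
  have sub_eq_zero' : matchings w - 1 - matchings w * archedMatchings w = 0 := by
    refine eq_zero_of_eq_mul (archedMatchings_self w) ?_
    nth_rw 1 2 [matchings_eq_one_add_arched_mul]
    rw [mul_sub, mul_sub, mul_one, add_mul, one_mul, mul_assoc]
    abel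
  rwa [sub_sub, sub_eq_zero] at sub_eq_zero'

theorem openMatchings_zero : openMatchings w u 0 = matchings w := by
  rw [openMatchings, pow_zero, mul_one]

theorem openMatchings_succ (k : ℕ) :
    openMatchings w u (k + 1) = matchings w * unmatched u * openMatchings w u k := by
  rw [openMatchings, openMatchings, pow_succ', mul_assoc, mul_assoc]

theorem openMatchings_succ' (k : ℕ) :
    openMatchings w u (k + 1) = openMatchings w u k * (unmatched u * matchings w) := by
  rw [openMatchings, openMatchings, pow_succ, mul_assoc]

theorem openMatchings_succ_self (k : ℕ) (a : ℤ) : openMatchings w u (k + 1) a a = 0 := by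
  rw [openMatchings_succ, IncidenceAlgebra.mul_apply, Finset.Icc_self, Finset.sum_singleton,
    mul_unmatched_apply, matchings_apply, matchingSum_of_lt w (sub_one_lt a), zero_mul, zero_mul]

theorem openMatchings_succ_eq_add_arched_mul (k : ℕ) : openMatchings w u (k + 1) =
    unmatched u * openMatchings w u k + archedMatchings w * openMatchings w u (k + 1) := by
  nth_rw 1 [openMatchings_succ, matchings_eq_one_add_arched_mul]
  rw [openMatchings_succ]
  noncomm_ring

theorem openMatchings_succ_eq_add_mul_arched (k : ℕ) : openMatchings w u (k + 1) =
    openMatchings w u k * unmatched u + openMatchings w u (k + 1) * archedMatchings w := by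
  nth_rw 1 [openMatchings_succ', matchings_eq_one_add_mul_arched]
  rw [openMatchings_succ']
  noncomm_ring

variable {w u} {p q : ℤ} {c : K}

theorem arched_mul_openMatchings_apply (k : ℕ)
    (h : ∀ x ∈ Finset.Ioc p q, w (p + 1) x = c * u x) :
    (archedMatchings w * openMatchings w u k) p q = c * openMatchings w u (k + 1) (p + 1) q := by
  rcases lt_or_ge q p with hqp | hpq
  · rw [IncidenceAlgebra.apply_eq_zero_of_not_le (by omega),
      IncidenceAlgebra.apply_eq_zero_of_not_le (by omega), mul_zero]
  rw [openMatchings_succ, IncidenceAlgebra.mul_apply, IncidenceAlgebra.mul_apply,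
    ← Finset.Ioc_insert_left hpq, Finset.sum_insert Finset.left_notMem_Ioc,
    archedMatchings_self, zero_mul, zero_add, Finset.mul_sum, ← Order.succ_eq_add_one,
    Finset.Icc_succ_left_eq_Ioc]
  refine Finset.sum_congr rfl fun x hx => ?_
  rw [mul_unmatched_apply, archedMatchings_apply, h x hx, matchings_apply, Order.succ_eq_add_one]
  ring

theorem openMatchings_mul_arched_apply (k : ℕ)
    (h : ∀ x ∈ Finset.Ioc p q, w x q = c * u x) :
    (openMatchings w u k * archedMatchings w) p q = c * openMatchings w u (k + 1) p (q - 1) := by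
  rcases lt_or_ge q p with hqp | hpq
  · rw [IncidenceAlgebra.apply_eq_zero_of_not_le (by omega),
      IncidenceAlgebra.apply_eq_zero_of_not_le (by omega), mul_zero]
  rw [openMatchings_succ', IncidenceAlgebra.mul_apply, IncidenceAlgebra.mul_apply,
    ← Finset.Ico_insert_right hpq, Finset.sum_insert Finset.right_notMem_Ico,
    archedMatchings_self, mul_zero, zero_add, Finset.mul_sum, ← Order.pred_eq_sub_one,
    Finset.Icc_pred_right_eq_Ico]
  refine Finset.sum_congr rfl fun x hx => ?_
  rw [unmatched_mul_apply, archedMatchings_apply, matchings_apply, Order.pred_eq_sub_one,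
    h (x + 1) (by simp only [Finset.mem_Ico, Finset.mem_Ioc] at hx ⊢; omega)]
  ring

theorem openMatchings_zero_apply (hpq : p ≠ q)
    (h : ∀ x ∈ Finset.Ioc p q, w x q = c * u x) :
    openMatchings w u 0 p q = c * openMatchings w u 1 p (q - 1) := by
  rw [← openMatchings_mul_arched_apply 0 h, openMatchings_zero]
  nth_rw 1 [matchings_eq_one_add_mul_arched]
  rw [IncidenceAlgebra.add_apply, IncidenceAlgebra.one_apply, if_neg hpq, zero_add]

theorem openMatchings_succ_apply (k : ℕ) (h : ∀ x ∈ Finset.Ioc p q, w x q = c * u x) :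
    openMatchings w u (k + 1) p q =
      openMatchings w u k p (q - 1) * u q + c * openMatchings w u (k + 2) p (q - 1) := by
  rw [openMatchings_succ_eq_add_mul_arched, IncidenceAlgebra.add_apply, mul_unmatched_apply,
    openMatchings_mul_arched_apply _ h]

theorem openMatchings_succ_apply' (k : ℕ) (h : ∀ x ∈ Finset.Ioc p q, w (p + 1) x = c * u x) :
    openMatchings w u (k + 1) p q =
      u (p + 1) * openMatchings w u k (p + 1) q + c * openMatchings w u (k + 2) (p + 1) q := by
  rw [openMatchings_succ_eq_add_arched_mul, IncidenceAlgebra.add_apply, unmatched_mul_apply,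
    arched_mul_openMatchings_apply _ h]

end Matching

section AbsWeight

/-- The weight of an arc between `x` and `y` that appears when the greatest letter is split off
from a permutation avoiding `132`: `s` to the power of the distance of `|x|` and `|y|`. -/
def absWeight {M : Type*} [Monoid M] (s : M) (x y : ℤ) : M :=
  s ^ (x.natAbs - y.natAbs : ℤ).natAbs

variable {K : Type*} [Field K] {s : K}

/-- `openMatchings` for `absWeight`. An unmatched `x` has weight `s⁻¹ ^ |x|`, so that the weight of
an arc between `x` and an outermost integer `y` is `s ^ |y|` times the weight of `x`. -/
noncomputable def absOpenMatchings (s : K) : ℕ → IncidenceAlgebra K ℤ :=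
  openMatchings (absWeight s) fun x => s⁻¹ ^ x.natAbs

theorem pow_natAbs_sub (hs : s ≠ 0) {a b : ℕ} (h : b ≤ a) :
    s ^ (a - b : ℤ).natAbs = s ^ a * s⁻¹ ^ b := by
  rw [inv_pow, ← pow_sub₀ _ hs h]
  congr 1
  omega

theorem absWeight_right (hs : s ≠ 0) (n : ℕ) :
    ∀ x ∈ Finset.Ioc (-n - 1 : ℤ) (n + 1),
      absWeight s x (n + 1) = s ^ (n + 1) * s⁻¹ ^ x.natAbs := by
  intro x hx
  rw [Finset.mem_Ioc] at hx
  rw [← pow_natAbs_sub hs (by omega), absWeight]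
  congr 1
  omega

theorem absWeight_left (hs : s ≠ 0) (n : ℕ) :
    ∀ x ∈ Finset.Ioc (-n - 1 : ℤ) n,
      absWeight s (-n - 1 + 1) x = s ^ n * s⁻¹ ^ x.natAbs := by
  intro x hx
  rw [Finset.mem_Ioc] at hx
  rw [← pow_natAbs_sub hs (by omega), absWeight]
  congr 1
  omega

theorem absOpenMatchings_left (hs : s ≠ 0) (k n : ℕ) :
    absOpenMatchings s (k + 1) (-n - 1) n =
      s⁻¹ ^ n * absOpenMatchings s k (-n) n + s ^ n * absOpenMatchings s (k + 2) (-n) n := by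
  rw [absOpenMatchings, openMatchings_succ_apply' k (absWeight_left hs n), sub_add_cancel,
    Int.natAbs_neg, Int.natAbs_natCast]

theorem absOpenMatchings_right (hs : s ≠ 0) (k n : ℕ) :
    absOpenMatchings s (k + 1) (-n - 1) (n + 1) =
      s⁻¹ ^ (n + 1) * absOpenMatchings s k (-n - 1) n +
        s ^ (n + 1) * absOpenMatchings s (k + 2) (-n - 1) n := by
  rw [absOpenMatchings, openMatchings_succ_apply k (absWeight_right hs n), add_sub_cancel_right,
    mul_comm]
  rfl

theorem absOpenMatchings_right_zero (hs : s ≠ 0) (n : ℕ) :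
    absOpenMatchings s 0 (-n - 1) (n + 1) = s ^ (n + 1) * absOpenMatchings s 1 (-n - 1) n := by
  rw [absOpenMatchings, openMatchings_zero_apply (by omega) (absWeight_right hs n),
    add_sub_cancel_right]

theorem absOpenMatchings_eq_pathSum (hs : s ≠ 0) (n g : ℕ) :
    s ^ (2 * n * g) * absOpenMatchings s (2 * g) (-n) n = s ^ n * pathSum (s ^ 2) n g := by
  induction n generalizing g with
  | zero =>
    rcases g with _ | g
    · simp [absOpenMatchings, openMatchings_zero, matchings_apply, matchingSum_self, pathSum]
    · simp [absOpenMatchings, Nat.mul_succ, openMatchings_succ_self, pathSum]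
  | succ n ih =>
    have ih (g : ℕ) : absOpenMatchings s (2 * g) (-n) n =
        s ^ n * pathSum (s ^ 2) n g / s ^ (2 * n * g) := by
      rw [← ih, mul_div_cancel_left₀ _ (pow_ne_zero _ hs)]
    push_cast
    rw [neg_add, ← sub_eq_add_neg]
    cases g with
    | zero =>
      rw [mul_zero, absOpenMatchings_right_zero hs, absOpenMatchings_left hs, ih 0, ih 1, pathSum,
        inv_pow]
      field_simp
      ring
    | succ g =>
      rw [Nat.mul_succ 2 g, absOpenMatchings_right hs, absOpenMatchings_left hs,
        absOpenMatchings_left hs, ← Nat.mul_succ, ← Nat.mul_succ, ih g, ih (g + 1), ih (g + 2),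
        pathSum]
      simp only [inv_pow]
      field_simp
      ring

theorem matchingSum_absWeight (hs : s ≠ 0) (n : ℕ) :
    matchingSum (absWeight s) (-n) n = s ^ n * pathSum (s ^ 2) n 0 := by
  rw [← absOpenMatchings_eq_pathSum hs, absOpenMatchings, mul_zero, mul_zero, pow_zero, one_mul,
    openMatchings_zero, matchings_apply]

end AbsWeight

/-! ### Splitting a 132-avoiding permutation at its greatest letter -/

/-- The crossing relation of two points `(position, letter)` of the graph of a permutation. -/
def CrossingPoints (x y : ℤ × ℤ) : Prop :=
  x.1 < y.1 ∧ x.2 < y.2 ∧ (y.1 < x.2 ∨ y.2 ≤ x.1)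

instance : DecidableRel CrossingPoints := fun x y => by unfold CrossingPoints; infer_instance

/-- The number of crossings of a finite set of points. -/
def crsPoints (A : Finset (ℤ × ℤ)) : ℕ :=
  ∑ y ∈ A, (A.filter fun x => CrossingPoints x y).card

/-- `A` is the graph of a bijection from `[p, p + n)` to `[v, v + n)` that avoids `132`. -/
structure IsGraph132 (p v : ℤ) (n : ℕ) (A : Finset (ℤ × ℤ)) : Prop where
  bijOn_fst : Set.BijOn Prod.fst (A : Set (ℤ × ℤ)) (Set.Ico p (p + n))
  bijOn_snd : Set.BijOn Prod.snd (A : Set (ℤ × ℤ)) (Set.Ico v (v + n))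
  avoids : ∀ x ∈ A, ∀ y ∈ A, ∀ z ∈ A, x.1 < y.1 → y.1 < z.1 → x.2 < z.2 → y.2 ≤ z.2

/-- The graph with greatest letter at `(p + l, v + l + m)`, left part `L` and right part `R`. -/
def joinGraphs (p v : ℤ) (l m : ℕ) (L R : Finset (ℤ × ℤ)) : Finset (ℤ × ℤ) :=
  insert (p + l, v + l + m) (L ∪ R)

theorem bijOn_insert_union {α β : Type*} {f : α → β} {a : α} {s t : Set α} {u v w : Set β}
    (hs : Set.BijOn f s u) (ht : Set.BijOn f t v) (ha : f a ∉ u ∪ v) (huv : Disjoint u v)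
    (hw : insert (f a) (u ∪ v) = w) : Set.BijOn f (insert a (s ∪ t)) w := by
  subst hw
  refine (hs.union ht ?_).insert ha
  have hst : Disjoint s t :=
    Set.disjoint_left.2 fun x hx hx' => Set.disjoint_left.1 huv (hs.mapsTo hx) (ht.mapsTo hx')
  exact (Set.injOn_union hst).2 ⟨hs.injOn, ht.injOn, fun x hx y hy =>
    huv.ne_of_mem (hs.mapsTo hx) (ht.mapsTo hy)⟩

theorem eq_Ico_of_union_eq_Ico {a b : ℤ} {s t : Finset ℤ} (hst : s ∪ t = Finset.Ico a b)
    (hlt : ∀ x ∈ s, ∀ y ∈ t, x < y) :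
    s = Finset.Ico a (a + s.card) ∧ t = Finset.Ico (a + s.card) b := by
  have mem_Ico (x : ℤ) : x ∈ s ∨ x ∈ t ↔ a ≤ x ∧ x < b := by
    rw [← Finset.mem_union, hst, Finset.mem_Ico]
  have hs : s = Finset.Ico a (a + s.card) := by
    refine Finset.eq_of_subset_of_card_le (fun x hx => ?_) (by simp)
    have Icc_subset : Finset.Icc a x ⊆ s := fun y hy => by
      rw [Finset.mem_Icc] at hy
      have hx' := (mem_Ico x).1 (.inl hx)
      exact ((mem_Ico y).2 (by omega)).resolve_right fun hy' => (hlt x hx y hy').not_ge hy.2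
    have := Finset.card_le_card Icc_subset
    rw [Int.card_Icc] at this
    have := (mem_Ico x).1 (.inl hx)
    rw [Finset.mem_Ico]
    omega
  refine ⟨hs, ?_⟩
  have disjoint : Disjoint s t := Finset.disjoint_left.2 fun x hx hx' => (hlt x hx x hx').false
  rw [← Finset.union_sdiff_cancel_left disjoint, hst, hs, Finset.Ico_sdiff_Ico_left, ← hs,
    max_eq_right (by omega)]

theorem mem_joinGraphs {p v : ℤ} {l m : ℕ} {L R : Finset (ℤ × ℤ)} {x : ℤ × ℤ} :
    x ∈ joinGraphs p v l m L R ↔ x = (p + l, v + l + m) ∨ x ∈ L ∨ x ∈ R := by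
  rw [joinGraphs, Finset.mem_insert, Finset.mem_union]

theorem isGraph132_zero_iff {p v : ℤ} {A : Finset (ℤ × ℤ)} : IsGraph132 p v 0 A ↔ A = ∅ := by
  constructor
  · intro h
    simpa using h.bijOn_fst.mapsTo
  · rintro rfl
    constructor <;> simp

namespace IsGraph132

variable {p v : ℤ} {n l m : ℕ} {A L R : Finset (ℤ × ℤ)}

theorem bounds (h : IsGraph132 p v n A) {x : ℤ × ℤ} (hx : x ∈ A) :
    (p ≤ x.1 ∧ x.1 < p + n) ∧ v ≤ x.2 ∧ x.2 < v + n :=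
  ⟨h.bijOn_fst.mapsTo hx, h.bijOn_snd.mapsTo hx⟩

theorem mem_left_iff_fst (hL : IsGraph132 p (v + m) l L) (hR : IsGraph132 (p + l + 1) v m R)
    {x : ℤ × ℤ} : x ∈ L ↔ x ∈ joinGraphs p v l m L R ∧ x.1 < p + l := by
  rw [mem_joinGraphs]
  constructor
  · exact fun hx => ⟨.inr (.inl hx), (hL.bounds hx).1.2⟩
  · rintro ⟨rfl | hx | hx, hlt⟩
    · exact (lt_irrefl _ hlt).elim
    · exact hx
    · have := hR.bounds hx
      omega

theorem mem_right_iff_fst (hL : IsGraph132 p (v + m) l L) (hR : IsGraph132 (p + l + 1) v m R)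
    {x : ℤ × ℤ} : x ∈ R ↔ x ∈ joinGraphs p v l m L R ∧ p + l < x.1 := by
  rw [mem_joinGraphs]
  constructor
  · exact fun hx => ⟨.inr (.inr hx), Int.lt_of_add_one_le (hR.bounds hx).1.1⟩
  · rintro ⟨rfl | hx | hx, hlt⟩
    · exact (lt_irrefl _ hlt).elim
    · have := hL.bounds hx
      omega
    · exact hx

theorem mem_right_iff_snd (hL : IsGraph132 p (v + m) l L) (hR : IsGraph132 (p + l + 1) v m R)
    {x : ℤ × ℤ} : x ∈ R ↔ x ∈ joinGraphs p v l m L R ∧ x.2 < v + m := by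
  rw [mem_joinGraphs]
  constructor
  · exact fun hx => ⟨.inr (.inr hx), (hR.bounds hx).2.2⟩
  · rintro ⟨rfl | hx | hx, hlt⟩
    · dsimp only at hlt
      omega
    · have := hL.bounds hx
      omega
    · exact hx

theorem join (hL : IsGraph132 p (v + m) l L) (hR : IsGraph132 (p + l + 1) v m R) :
    IsGraph132 p v (l + m + 1) (joinGraphs p v l m L R) where
  bijOn_fst := by
    rw [joinGraphs, Finset.coe_insert, Finset.coe_union]
    refine bijOn_insert_union hL.bijOn_fst hR.bijOn_fst ?_ ?_ ?_
    · simp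
    · rw [Set.disjoint_left]
      simp only [Set.mem_Ico]
      omega
    · ext
      simp only [Set.mem_insert_iff, Set.mem_union, Set.mem_Ico]
      omega
  bijOn_snd := by
    rw [joinGraphs, Finset.coe_insert, Finset.coe_union]
    refine bijOn_insert_union hL.bijOn_snd hR.bijOn_snd ?_ ?_ ?_
    · simp only [Set.mem_union, Set.mem_Ico]
      omega
    · rw [Set.disjoint_left]
      simp only [Set.mem_Ico]
      omega
    · ext
      simp only [Set.mem_insert_iff, Set.mem_union, Set.mem_Ico]
      omega
  avoids := by
    intro x hx y hy z hz hxy hyz hxz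
    rcases mem_joinGraphs.1 hz with rfl | hzL | hzR
    · rcases mem_joinGraphs.1 hy with rfl | hyL | hyR
      · rfl
      · have := hL.bounds hyL
        dsimp only
        omega
      · have := hR.bounds hyR
        dsimp only
        omega
    · have := (mem_left_iff_fst hL hR).1 hzL
      exact hL.avoids x ((mem_left_iff_fst hL hR).2 ⟨hx, by omega⟩) y
        ((mem_left_iff_fst hL hR).2 ⟨hy, by omega⟩) z hzL hxy hyz hxz
    · have hxR : x ∈ R := (mem_right_iff_snd hL hR).2 ⟨hx, hxz.trans (hR.bounds hzR).2.2⟩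
      have := (mem_right_iff_fst hL hR).1 hxR
      exact hR.avoids x hxR y ((mem_right_iff_fst hL hR).2 ⟨hy, by omega⟩) z hzR hxy hyz hxz

theorem image_filter_fst (h : IsGraph132 p v n A) (P : ℤ → Prop) [DecidablePred P] :
    (A.filter fun x => P x.1).image Prod.fst = (Finset.Ico p (p + n)).filter P := by
  have image_fst : A.image Prod.fst = Finset.Ico p (p + n) := by
    rw [← Finset.coe_inj, Finset.coe_image, Finset.coe_Ico, h.bijOn_fst.image_eq]
  rw [← image_fst, Finset.filter_image]

theorem image_filter_snd (h : IsGraph132 p v n A) (P : ℤ → Prop) [DecidablePred P] :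
    (A.filter fun x => P x.2).image Prod.snd = (Finset.Ico v (v + n)).filter P := by
  have image_snd : A.image Prod.snd = Finset.Ico v (v + n) := by
    rw [← Finset.coe_inj, Finset.coe_image, Finset.coe_Ico, h.bijOn_snd.image_eq]
  rw [← image_snd, Finset.filter_image]

theorem fst_eq_fst_iff (h : IsGraph132 p v n A) {x y : ℤ × ℤ} (hx : x ∈ A) (hy : y ∈ A) :
    x.1 = y.1 ↔ x.2 = y.2 :=
  (h.bijOn_fst.injOn.eq_iff hx hy).trans (h.bijOn_snd.injOn.eq_iff hx hy).symm

theorem of_subset (h : IsGraph132 p v n A) {q w : ℤ} {B : Finset (ℤ × ℤ)} (hBA : B ⊆ A)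
    (hfst : B.image Prod.fst = Finset.Ico q (q + m))
    (hsnd : B.image Prod.snd = Finset.Ico w (w + m)) : IsGraph132 q w m B where
  bijOn_fst := by
    rw [← Finset.coe_Ico, ← hfst, Finset.coe_image]
    exact (h.bijOn_fst.injOn.mono hBA).bijOn_image
  bijOn_snd := by
    rw [← Finset.coe_Ico, ← hsnd, Finset.coe_image]
    exact (h.bijOn_snd.injOn.mono hBA).bijOn_image
  avoids x hx y hy z hz := h.avoids x (hBA hx) y (hBA hy) z (hBA hz)

theorem snd_lt_snd_of_top (h : IsGraph132 p v (n + 1) A) {j : ℤ} (top_mem : (j, v + n) ∈ A)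
    {x y : ℤ × ℤ} (hx : x ∈ A) (hy : y ∈ A) (hxj : x.1 < j) (hjy : j < y.1) : y.2 < x.2 := by
  have hxy := h.fst_eq_fst_iff hx hy
  have hy_top := h.fst_eq_fst_iff hy top_mem
  have := h.bounds hy
  have := h.avoids x hx _ top_mem y hy hxj hjy
  dsimp only at *
  push_cast at *
  omega

theorem image_snd_union (h : IsGraph132 p v (n + 1) A) {j : ℤ} (top_mem : (j, v + n) ∈ A) :
    (A.filter fun x => j < x.1).image Prod.snd ∪ (A.filter fun x => x.1 < j).image Prod.snd =
      Finset.Ico v (v + n) := by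
  have filter_or : (A.filter fun x => j < x.1 ∨ x.1 < j) = A.filter fun x => x.2 ≠ v + n := by
    refine Finset.filter_congr fun x hx => ?_
    rw [← (h.fst_eq_fst_iff hx top_mem).ne]
    exact lt_or_lt_iff_ne.trans ne_comm
  rw [← Finset.image_union, ← Finset.filter_or, filter_or, h.image_filter_snd (· ≠ v + n)]
  ext
  simp only [Finset.mem_filter, Finset.mem_Ico]
  omega

theorem eq_joinGraphs_filter (h : IsGraph132 p v n A) (top_mem : (p + l, v + l + m) ∈ A) :
    A = joinGraphs p v l m (A.filter fun x => x.1 < p + l) (A.filter fun x => p + l < x.1) := by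
  ext x
  rw [mem_joinGraphs, Finset.mem_filter, Finset.mem_filter]
  constructor
  · intro hx
    rcases lt_trichotomy x.1 (p + l) with hlt | heq | hgt
    · exact .inr (.inl ⟨hx, hlt⟩)
    · exact .inl (h.bijOn_fst.injOn hx top_mem heq)
    · exact .inr (.inr ⟨hx, hgt⟩)
  · rintro (rfl | hx | hx)
    exacts [top_mem, hx.1, hx.1]

theorem exists_join (h : IsGraph132 p v (n + 1) A) : ∃ l m L R, l + m = n ∧
    IsGraph132 p (v + m) l L ∧ IsGraph132 (p + l + 1) v m R ∧ A = joinGraphs p v l m L R := by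
  obtain ⟨⟨j, w⟩, top_mem, hw⟩ := h.bijOn_snd.surjOn (a := v + n) (by simp)
  obtain rfl : w = v + n := hw
  have j_mem := (h.bounds top_mem).1
  obtain ⟨l, m, rfl, rfl⟩ : ∃ l m : ℕ, l + m = n ∧ j = p + l :=
    ⟨(j - p).toNat, n - (j - p).toNat, by dsimp only at j_mem; omega⟩
  have left_fst : (A.filter fun x => x.1 < p + l).image Prod.fst = Finset.Ico p (p + l) := by
    rw [h.image_filter_fst (· < p + l)]
    ext
    simp only [Finset.mem_filter, Finset.mem_Ico]
    omega
  have right_fst : (A.filter fun x => p + l < x.1).image Prod.fst =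
      Finset.Ico (p + l + 1) (p + l + 1 + m) := by
    rw [h.image_filter_fst (p + l < ·)]
    ext
    simp only [Finset.mem_filter, Finset.mem_Ico]
    omega
  have right_card : ((A.filter fun x => p + l < x.1).image Prod.snd).card = m := by
    rw [Finset.card_image_of_injOn (h.bijOn_snd.injOn.mono (A.filter_subset _)),
      ← Finset.card_image_of_injOn (h.bijOn_fst.injOn.mono (A.filter_subset _)), right_fst,
      Int.card_Ico]
    omega
  obtain ⟨right_snd, left_snd⟩ := eq_Ico_of_union_eq_Ico (h.image_snd_union top_mem) <| by
    simp only [Finset.forall_mem_image, Finset.mem_filter]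
    exact fun y hy x hx => h.snd_lt_snd_of_top top_mem hx.1 hy.1 hx.2 hy.2
  rw [right_card] at right_snd left_snd
  refine ⟨l, m, _, _, rfl, h.of_subset (A.filter_subset _) left_fst ?_,
    h.of_subset (A.filter_subset _) right_fst right_snd, ?_⟩
  · rw [left_snd]
    push_cast
    ring_nf
  · exact h.eq_joinGraphs_filter (by simpa [add_assoc] using top_mem)

theorem filter_crossing_left (hL : IsGraph132 p (v + m) l L)
    (hR : IsGraph132 (p + l + 1) v m R) {y : ℤ × ℤ} (hy : y.1 ≤ p + l) :
    (joinGraphs p v l m L R).filter (CrossingPoints · y) = L.filter (CrossingPoints · y) := by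
  ext x
  rw [Finset.mem_filter, Finset.mem_filter, mem_left_iff_fst hL hR]
  exact ⟨fun ⟨hx, hxy⟩ => ⟨⟨hx, hxy.1.trans_le hy⟩, hxy⟩, fun ⟨hx, hxy⟩ => ⟨hx.1, hxy⟩⟩

theorem filter_crossing_right (hL : IsGraph132 p (v + m) l L)
    (hR : IsGraph132 (p + l + 1) v m R) {y : ℤ × ℤ} (hy : y.2 ≤ v + m) :
    (joinGraphs p v l m L R).filter (CrossingPoints · y) = R.filter (CrossingPoints · y) := by
  ext x
  rw [Finset.mem_filter, Finset.mem_filter, mem_right_iff_snd hL hR]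
  exact ⟨fun ⟨hx, hxy⟩ => ⟨⟨hx, hxy.2.1.trans_le hy⟩, hxy⟩, fun ⟨hx, hxy⟩ => ⟨hx.1, hxy⟩⟩

theorem crsPoints_join (hL : IsGraph132 p (v + m) l L) (hR : IsGraph132 (p + l + 1) v m R) :
    crsPoints (joinGraphs p v l m L R) =
      (L.filter (CrossingPoints · (p + l, v + l + m))).card + (crsPoints L + crsPoints R) := by
  have top_notMem : ((p + l, v + l + m) : ℤ × ℤ) ∉ L ∪ R := by
    rw [Finset.mem_union]
    rintro (hx | hx)
    · exact lt_irrefl _ ((mem_left_iff_fst hL hR).1 hx).2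
    · exact lt_irrefl _ ((mem_right_iff_fst hL hR).1 hx).2
  have disjoint : Disjoint L R := Finset.disjoint_left.2 fun x hx hx' =>
    ((mem_left_iff_fst hL hR).1 hx).2.not_gt ((mem_right_iff_fst hL hR).1 hx').2
  rw [crsPoints, joinGraphs, Finset.sum_insert top_notMem, Finset.sum_union disjoint,
    ← joinGraphs, filter_crossing_left hL hR le_rfl]
  congr 2
  · refine Finset.sum_congr rfl fun y hy => ?_
    rw [filter_crossing_left hL hR (hL.bounds hy).1.2.le]
  · refine Finset.sum_congr rfl fun y hy => ?_
    rw [filter_crossing_right hL hR (hR.bounds hy).2.2.le]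

theorem two_mul_card_crossing_top_add_one {w : ℤ} (h : IsGraph132 p w l L) :
    2 * (L.filter (CrossingPoints · (p + l, w + l))).card + 1 =
      ((p - w - l).natAbs - (p - w + l + 1).natAbs : ℤ).natAbs := by
  rcases lt_or_ge p w with hpw | hwp
  · have filter_eq : L.filter (CrossingPoints · (p + l, w + l)) =
        L.filter fun x => p + l < x.2 := by
      refine Finset.filter_congr fun x hx => ?_
      have := h.bounds hx
      rw [CrossingPoints]
      omega
    have card_eq : (L.filter fun x => p + l < x.2).card = (w + l - max w (p + l + 1)).toNat := by
      rw [← Finset.card_image_of_injOn (h.bijOn_snd.injOn.mono (L.filter_subset _)),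
        h.image_filter_snd (p + l < ·), ← Int.card_Ico]
      congr 1
      ext
      simp only [Finset.mem_filter, Finset.mem_Ico]
      omega
    rw [filter_eq, card_eq]
    omega
  · have filter_eq : L.filter (CrossingPoints · (p + l, w + l)) =
        L.filter fun x => w + l ≤ x.1 := by
      refine Finset.filter_congr fun x hx => ?_
      have := h.bounds hx
      rw [CrossingPoints]
      omega
    have card_eq : (L.filter fun x => w + l ≤ x.1).card = (p + l - max p (w + l)).toNat := by
      rw [← Finset.card_image_of_injOn (h.bijOn_fst.injOn.mono (L.filter_subset _)),
        h.image_filter_fst (w + l ≤ ·), ← Int.card_Ico]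
      congr 1
      ext
      simp only [Finset.mem_filter, Finset.mem_Ico]
      omega
    rw [filter_eq, card_eq]
    omega

end IsGraph132

namespace IsGraph132

variable {p v : ℤ} {n l m l' m' : ℕ} {A L R L' R' : Finset (ℤ × ℤ)}

theorem left_length_unique (hL : IsGraph132 p (v + m) l L) (hR : IsGraph132 (p + l + 1) v m R)
    (hlm : l + m = l' + m') (h : joinGraphs p v l m L R = joinGraphs p v l' m' L' R') :
    l = l' := by
  have top_mem : (p + l, v + l + m) ∈ joinGraphs p v l m L R := mem_joinGraphs.2 (.inl rfl)
  have top_mem' : (p + l', v + l' + m') ∈ joinGraphs p v l m L R :=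
    h ▸ mem_joinGraphs.2 (.inl rfl)
  have := ((hL.join hR).fst_eq_fst_iff top_mem top_mem').2 (by dsimp only; omega)
  dsimp only at this
  omega

theorem join_injective (hL : IsGraph132 p (v + m) l L) (hR : IsGraph132 (p + l + 1) v m R)
    (hL' : IsGraph132 p (v + m) l L') (hR' : IsGraph132 (p + l + 1) v m R')
    (h : joinGraphs p v l m L R = joinGraphs p v l m L' R') : L = L' ∧ R = R' := by
  constructor
  · ext x
    rw [mem_left_iff_fst hL hR, mem_left_iff_fst hL' hR', h]
  · ext x
    rw [mem_right_iff_fst hL hR, mem_right_iff_fst hL' hR', h]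

end IsGraph132

open Classical in
/-- The graphs of the `132`-avoiding bijections from `[p, p + n)` to `[v, v + n)`. -/
noncomputable def graphs132 (p v : ℤ) (n : ℕ) : Finset (Finset (ℤ × ℤ)) :=
  (Finset.Ico p (p + n) ×ˢ Finset.Ico v (v + n)).powerset.filter (IsGraph132 p v n)

theorem mem_graphs132 {p v : ℤ} {n : ℕ} {A : Finset (ℤ × ℤ)} :
    A ∈ graphs132 p v n ↔ IsGraph132 p v n A := by
  simp only [graphs132, Finset.mem_filter, Finset.mem_powerset, and_iff_right_iff_imp]
  intro h x hx
  rw [Finset.mem_product, Finset.mem_Ico, Finset.mem_Ico]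
  exact h.bounds hx

theorem graphs132_zero (p v : ℤ) : graphs132 p v 0 = {∅} := by
  ext A
  rw [mem_graphs132, isGraph132_zero_iff, Finset.mem_singleton]

theorem sum_graphs132_succ {M : Type*} [AddCommMonoid M] (F : Finset (ℤ × ℤ) → M) (p v : ℤ)
    (n : ℕ) : ∑ A ∈ graphs132 p v (n + 1), F A = ∑ x ∈ Finset.HasAntidiagonal.antidiagonal n,
      ∑ y ∈ graphs132 p (v + x.2) x.1 ×ˢ graphs132 (p + x.1 + 1) v x.2,
        F (joinGraphs p v x.1 x.2 y.1 y.2) := by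
  rw [Finset.sum_sigma']
  symm
  refine Finset.sum_bij (fun z _ => joinGraphs p v z.1.1 z.1.2 z.2.1 z.2.2) ?_ ?_ ?_
    fun _ _ => rfl
  all_goals simp only [Finset.mem_sigma, Finset.HasAntidiagonal.mem_antidiagonal,
    Finset.mem_product, mem_graphs132]
  · rintro ⟨⟨l, m⟩, L, R⟩ ⟨rfl, hL, hR⟩
    exact hL.join hR
  · rintro ⟨⟨l, m⟩, L, R⟩ ⟨hlm, hL, hR⟩ ⟨⟨l', m'⟩, L', R'⟩ ⟨hlm', hL', hR'⟩ h
    dsimp only at *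
    obtain rfl := hL.left_length_unique hR (hlm.trans hlm'.symm) h
    obtain rfl : m = m' := by omega
    obtain ⟨rfl, rfl⟩ := hL.join_injective hR hL' hR' h
    rfl
  · intro A hA
    obtain ⟨l, m, L, R, hlm, hL, hR, rfl⟩ := hA.exists_join
    exact ⟨⟨(l, m), L, R⟩, ⟨hlm, hL, hR⟩, rfl⟩

theorem pow_length_mul_pow_crsPoints_join {K : Type*} [CommRing K] (s : K) {p v : ℤ} {l m : ℕ}
    {L R : Finset (ℤ × ℤ)} (hL : IsGraph132 p (v + m) l L)
    (hR : IsGraph132 (p + l + 1) v m R) :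
    s ^ (l + m + 1) * (s ^ 2) ^ crsPoints (joinGraphs p v l m L R) =
      absWeight s (p - v - m - l) (p - v - m + l + 1) * (s ^ l * (s ^ 2) ^ crsPoints L) *
        (s ^ m * (s ^ 2) ^ crsPoints R) := by
  have top := hL.two_mul_card_crossing_top_add_one
  rw [← sub_sub, add_right_comm v] at top
  rw [hL.crsPoints_join hR, absWeight, ← top]
  ring

/-- The greatest letter corresponds to the first arc: the points on its left form the part under
the arc and the points on its right the part behind it. -/
theorem pow_mul_sum_graphs132 {K : Type*} [CommRing K] (s : K) (n : ℕ) (p v : ℤ) :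
    s ^ n * ∑ A ∈ graphs132 p v n, (s ^ 2) ^ crsPoints A =
      matchingSum (absWeight s) (p - v - n) (p - v + n) := by
  induction n using Nat.strong_induction_on generalizing p v with
  | _ n ih =>
  rcases n with _ | n
  · simp [graphs132_zero, crsPoints, matchingSum_self]
  have interval_eq : p - v + (n + 1 : ℕ) = p - v - (n + 1 : ℕ) + 2 * n + 2 := by
    push_cast
    ring
  rw [sum_graphs132_succ, interval_eq, matchingSum_eq_sum_antidiagonal, Finset.mul_sum]
  refine Finset.sum_congr rfl fun ⟨l, m⟩ hx => ?_
  obtain rfl := Finset.HasAntidiagonal.mem_antidiagonal.1 hx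
  have left := ih l (by dsimp only; omega) p (v + m)
  have right := ih m (by dsimp only; omega) (p + l + 1) v
  have arc_start : p - v - (l + m + 1 : ℕ) + 1 = p - v - m - l := by push_cast; ring
  have arc_end : p - v - (l + m + 1 : ℕ) + 2 * l + 2 = p - v - m + l + 1 := by push_cast; ring
  have under_end : p - v - (l + m + 1 : ℕ) + 2 * l + 1 = p - v - m + l := by push_cast; ring
  have last : p - v - (l + m + 1 : ℕ) + 2 * (l + m : ℕ) + 2 = p + l + 1 - v + m := by
    push_cast
    ring
  have right_start : p + l + 1 - v - m = p - v - m + l + 1 := by ring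
  rw [← sub_sub] at left
  rw [right_start] at right
  dsimp only
  rw [arc_start, arc_end, under_end, last, ← left, ← right, Finset.mul_sum, Finset.mul_sum,
    Finset.mul_sum, Finset.mul_sum, Finset.sum_mul_sum, ← Finset.sum_product']
  refine Finset.sum_congr rfl fun ⟨L, R⟩ hLR => ?_
  rw [Finset.mem_product, mem_graphs132, mem_graphs132] at hLR
  exact pow_length_mul_pow_crsPoints_join s hLR.1 hLR.2

/-- The embedding of the positions of `σ` as the points of its graph. -/
def graphPoint {n : ℕ} (σ : S n) : Fin n ↪ ℤ × ℤ where
  toFun i := ((i : ℕ), (σ i : ℕ))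
  inj' i j h := by simpa [Fin.val_inj] using congrArg Prod.fst h

theorem graphPoint_apply {n : ℕ} (σ : S n) (i : Fin n) :
    graphPoint σ i = (((i : ℕ) : ℤ), ((σ i : ℕ) : ℤ)) :=
  rfl

/-- The graph of a permutation, as a set of points `(position, letter)`. -/
def graph {n : ℕ} (σ : S n) : Finset (ℤ × ℤ) :=
  Finset.univ.map (graphPoint σ)

theorem crossingPoints_graphPoint_iff {n : ℕ} {σ : S n} {i j : Fin n} :
    CrossingPoints (graphPoint σ i) (graphPoint σ j) ↔ IsCrossing σ i j := by
  rw [IsCrossing, CrossingPoints, graphPoint_apply, graphPoint_apply]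
 
  omega

theorem crsPoints_graph {n : ℕ} (σ : S n) : crsPoints (graph σ) = crs n σ := by
  rw [crsPoints, graph, Finset.sum_map, crs, Finset.card_filter, Fintype.sum_prod_type_right]
  refine Finset.sum_congr rfl fun j _ => ?_
  simp only [Finset.filter_map, Finset.card_map, Finset.card_filter, Function.comp_apply,
    crossingPoints_graphPoint_iff]

theorem graph_injective (n : ℕ) : Function.Injective (graph (n := n)) := by
  intro σ τ h
  ext i
  have : graphPoint σ i ∈ graph τ := h ▸ Finset.mem_map_of_mem _ (Finset.mem_univ i)
  obtain ⟨j, -, hj⟩ := Finset.mem_map.1 this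
  simp only [graphPoint_apply, Prod.mk.injEq, Nat.cast_inj, Fin.val_inj] at hj
  rw [← hj.2, hj.1]

theorem bijOn_graph {n : ℕ} {σ : S n} {f : ℤ × ℤ → ℤ} (e : S n)
    (hf : ∀ i, f (graphPoint σ i) = (e i : ℕ)) :
    Set.BijOn f (graph σ) (Set.Ico 0 (0 + n)) := by
  rw [graph, Finset.coe_map, Finset.coe_univ]
  refine ⟨?_, ?_, ?_⟩
  · rintro _ ⟨i, -, rfl⟩
    simp [hf]
  · rintro _ ⟨i, -, rfl⟩ _ ⟨j, -, rfl⟩ hij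
    simpa [hf, Fin.val_inj] using hij
  · intro y hy
    rw [Set.mem_Ico] at hy
    refine ⟨_, ⟨e.symm ⟨y.toNat, by omega⟩, trivial, rfl⟩, ?_⟩
    rw [hf, Equiv.apply_symm_apply, Int.toNat_of_nonneg hy.1]

theorem isGraph132_graph_iff {n : ℕ} {σ : S n} :
    IsGraph132 0 0 n (graph σ) ↔ ¬ Contains p132 σ := by
  have avoids_iff : (∀ x ∈ graph σ, ∀ y ∈ graph σ, ∀ z ∈ graph σ,
      x.1 < y.1 → y.1 < z.1 → x.2 < z.2 → y.2 ≤ z.2) ↔ ¬ Contains p132 σ := by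
    rw [contains_p132_iff]
    simp only [graph, Finset.forall_mem_map, Finset.mem_univ, forall_const, graphPoint_apply,
      Nat.cast_lt, Nat.cast_le, Fin.val_fin_lt, Fin.val_fin_le, not_exists, not_and, not_lt]
  exact ⟨fun h => avoids_iff.1 h.avoids, fun h =>
    ⟨bijOn_graph 1 fun _ => rfl, bijOn_graph σ fun _ => rfl, avoids_iff.2 h⟩⟩

theorem IsGraph132.exists_graph {n : ℕ} {A : Finset (ℤ × ℤ)} (h : IsGraph132 0 0 n A) :
    ∃ σ : S n, graph σ = A := by
  have exists_letter (i : Fin n) : ∃ j : Fin n, (((i : ℕ) : ℤ), ((j : ℕ) : ℤ)) ∈ A := by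
    obtain ⟨⟨a, b⟩, hx, rfl⟩ := h.bijOn_fst.surjOn (a := i) (by simp)
    have := (h.bounds hx).2
    refine ⟨⟨b.toNat, by dsimp only at this; omega⟩, ?_⟩
    rwa [Int.toNat_of_nonneg this.1]
  choose f hf using exists_letter
  have f_injective : Function.Injective f := fun i j hij => by
    have := (h.fst_eq_fst_iff (hf i) (hf j)).2 (by rw [hij])
    exact Fin.ext (Nat.cast_inj.1 this)
  let σ : S n := Equiv.ofBijective f (Finite.injective_iff_bijective.1 f_injective)
  have graph_subset : graph σ ⊆ A := by
    intro x hx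
    obtain ⟨i, -, rfl⟩ := Finset.mem_map.1 hx
    exact hf i
  refine ⟨σ, Finset.eq_of_subset_of_card_le graph_subset ?_⟩
  rw [graph, Finset.card_map, Finset.card_univ, Fintype.card_fin]
  have := Finset.card_le_card_of_injOn (t := Finset.Ico 0 (0 + (n : ℤ))) Prod.fst
    (by simpa using h.bijOn_fst.mapsTo) h.bijOn_fst.injOn
  simpa using this

theorem sum_avoiders_p132 {M : Type*} [AddCommMonoid M] (F : ℕ → M) (n : ℕ) :
    ∑ σ ∈ avoiders {⟨3, p132⟩} n, F (crs n σ) = ∑ A ∈ graphs132 0 0 n, F (crsPoints A) := by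
  refine Finset.sum_bij (fun σ _ => graph σ) ?_ (fun σ _ τ _ h => graph_injective n h) ?_ ?_
  · intro σ hσ
    rwa [mem_graphs132, isGraph132_graph_iff, ← mem_avoiders_singleton]
  · intro A hA
    rw [mem_graphs132] at hA
    obtain ⟨σ, rfl⟩ := hA.exists_graph
    exact ⟨σ, mem_avoiders_singleton.2 (isGraph132_graph_iff.1 hA), rfl⟩
  · intro σ _
    rw [crsPoints_graph]

theorem sum_pow_crs_p132 {K : Type*} [Field K] {s : K} (hs : s ≠ 0) (n : ℕ) :
    ∑ σ ∈ avoiders {⟨3, p132⟩} n, (s ^ 2) ^ crs n σ = pathSum (s ^ 2) n 0 := by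
  rw [sum_avoiders_p132 fun k => (s ^ 2) ^ k]
  refine mul_left_cancel₀ (pow_ne_zero n hs) ?_
  rw [← matchingSum_absWeight hs, pow_mul_sum_graphs132]
  simp

/-! ### The Wilf equivalence classes -/

section Specialization

variable {k l : ℕ} {T T' : Set Pattern}

theorem wilfEquiv_of_sum_pow_eq {K : Type*} [CommRing K] [IsDomain K] [CharZero K]
    {st : Statistic} {A : Set K} (hA : A.Infinite)
    (h : ∀ n, ∀ q ∈ A, ∑ σ ∈ avoiders T n, q ^ st n σ = ∑ σ ∈ avoiders T' n, q ^ st n σ) :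
    WilfEquiv ![st] T T' := by
  intro n
  have sum_X_pow_eq : ∑ σ ∈ avoiders T n, (Polynomial.X : Polynomial ℤ) ^ st n σ =
      ∑ σ ∈ avoiders T' n, Polynomial.X ^ st n σ := by
    apply Polynomial.map_injective (Int.castRingHom K) Int.cast_injective
    refine Polynomial.eq_of_infinite_eval_eq _ _ (hA.mono fun q hq => ?_)
    simpa [Polynomial.eval_finsetSum, Polynomial.map_sum] using h n q hq
  have := congrArg (Polynomial.aeval (MvPolynomial.X 0 : MvPolynomial (Fin 1) ℤ)) sum_X_pow_eq
  simpa [genPoly] using this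

theorem aeval_genPoly {R : Type*} [CommRing R] (st : Fin k → Statistic) (T : Set Pattern) (n : ℕ)
    (x : Fin k → R) :
    MvPolynomial.aeval x (genPoly st T n) = ∑ σ ∈ avoiders T n, ∏ m, x m ^ st m n σ := by
  simp [genPoly]

theorem WilfEquiv.sum_pow_eq {R : Type*} [CommRing R] {st : Fin k → Statistic}
    (h : WilfEquiv st T T') (m : Fin k) (n : ℕ) (q : R) :
    ∑ σ ∈ avoiders T n, q ^ st m n σ = ∑ σ ∈ avoiders T' n, q ^ st m n σ := by
  have := congrArg (MvPolynomial.aeval (Pi.mulSingle m q)) (h n)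
  simpa [aeval_genPoly, Pi.mulSingle_apply, ite_pow] using this

theorem WilfEquiv.single {st : Fin k → Statistic} (h : WilfEquiv st T T') (m : Fin k) :
    WilfEquiv ![st m] T T' :=
  wilfEquiv_of_sum_pow_eq (Set.infinite_univ (α := ℤ)) fun n q _ => h.sum_pow_eq m n q

end Specialization

theorem wilfEquiv_crs_p132_p321 : WilfEquiv ![crs] {⟨3, p132⟩} {⟨3, p321⟩} := by
  refine wilfEquiv_of_sum_pow_eq (Set.Ioi_infinite (0 : ℝ)) fun n q hq => ?_
  rw [← Real.sq_sqrt (le_of_lt hq), sum_pow_crs_p132 (Real.sqrt_pos.2 hq).ne', sum_pow_crs_p321]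

theorem wilfEquiv_crs_nes_p132_p213 : WilfEquiv ![crs, nes] {⟨3, p132⟩} {⟨3, p213⟩} := by
  have p213_eq : reverseComplementInverse p132 = p213 := by decide
  exact p213_eq ▸ wilfEquiv_crs_nes_reverseComplementInverse p132

theorem wilfEquiv_nes_p231_p312 : WilfEquiv ![nes] {⟨3, p231⟩} {⟨3, p312⟩} :=
  wilfEquiv_nes_inv p231

/-- The value at `2` of the generating polynomial of `st` over the permutations of length `n` that
avoid `τ`, in a form that can be evaluated. Length `4` suffices to tell patterns of length three
apart. -/
def weight (st : Statistic) (τ : S 3) (n : ℕ) : ℕ :=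
  ∑ σ : S n with ¬ Contains τ σ, 2 ^ st n σ

theorem weight_eq_sum_avoiders (st : Statistic) (τ : S 3) (n : ℕ) :
    weight st τ n = ∑ σ ∈ avoiders {⟨3, τ⟩} n, 2 ^ st n σ := by
  rw [weight]
  congr 1
  ext σ
  rw [mem_avoiders_singleton, Finset.mem_filter_univ]

theorem WilfEquiv.weight_eq {k : ℕ} {st : Fin k → Statistic} {τ τ' : S 3}
    (h : WilfEquiv st {⟨3, τ⟩} {⟨3, τ'⟩}) (m : Fin k) (n : ℕ) :
    weight (st m) τ n = weight (st m) τ' n := by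
  zify
  simpa [weight_eq_sum_avoiders] using h.sum_pow_eq m n (2 : ℤ)

theorem wilfEquiv_nes_iff {π τ : S 3} :
    WilfEquiv ![nes] {⟨3, π⟩} {⟨3, τ⟩} ↔ weight nes π 4 = weight nes τ 4 := by
  refine ⟨fun h => h.weight_eq 0 4, fun h => ?_⟩
  have cases : ∀ π τ, weight nes π 4 = weight nes τ 4 → π = τ ∨
      (π = p132 ∧ τ = p213) ∨ (π = p213 ∧ τ = p132) ∨
      (π = p231 ∧ τ = p312) ∨ (π = p312 ∧ τ = p231) := by decide +kernel
  have h132 := wilfEquiv_crs_nes_p132_p213.single 1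
  have h231 := wilfEquiv_nes_p231_p312
  rcases cases π τ h with rfl | ⟨rfl, rfl⟩ | ⟨rfl, rfl⟩ | ⟨rfl, rfl⟩ | ⟨rfl, rfl⟩
  exacts [(wilfSetoid _ 3).refl _, h132, (wilfSetoid _ 3).symm h132, h231,
    (wilfSetoid _ 3).symm h231]

theorem wilfEquiv_crs_iff {π τ : S 3} :
    WilfEquiv ![crs] {⟨3, π⟩} {⟨3, τ⟩} ↔ weight crs π 4 = weight crs τ 4 := by
  refine ⟨fun h => h.weight_eq 0 4, fun h => ?_⟩
  have cases : ∀ π τ, weight crs π 4 = weight crs τ 4 → π = τ ∨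
      (π = p132 ∨ π = p213 ∨ π = p321) ∧ (τ = p132 ∨ τ = p213 ∨ τ = p321) := by decide +kernel
  have p132_equiv (τ : S 3) (hτ : τ = p132 ∨ τ = p213 ∨ τ = p321) :
      wilfSetoid ![crs] 3 p132 τ := by
    rcases hτ with rfl | rfl | rfl
    exacts [(wilfSetoid _ 3).refl _, wilfEquiv_crs_nes_p132_p213.single 0,
      wilfEquiv_crs_p132_p321]
  rcases cases π τ h with rfl | ⟨hπ, hτ⟩
  · exact (wilfSetoid _ 3).refl _
  · exact (wilfSetoid _ 3).trans ((wilfSetoid _ 3).symm (p132_equiv π hπ)) (p132_equiv τ hτ)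

theorem wilfEquiv_crs_nes_iff {π τ : S 3} : WilfEquiv ![crs, nes] {⟨3, π⟩} {⟨3, τ⟩} ↔
    weight crs π 4 = weight crs τ 4 ∧ weight nes π 4 = weight nes τ 4 := by
  refine ⟨fun h => ⟨h.weight_eq 0 4, h.weight_eq 1 4⟩, fun h => ?_⟩
  have cases : ∀ π τ, weight crs π 4 = weight crs τ 4 ∧ weight nes π 4 = weight nes τ 4 →
      π = τ ∨ (π = p132 ∧ τ = p213) ∨ (π = p213 ∧ τ = p132) := by decide +kernel
  rcases cases π τ h with rfl | ⟨rfl, rfl⟩ | ⟨rfl, rfl⟩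
  exacts [(wilfSetoid _ 3).refl _, wilfEquiv_crs_nes_p132_p213,
    (wilfSetoid _ 3).symm wilfEquiv_crs_nes_p132_p213]

theorem wilfClasses_eq {k l : ℕ} {st : Fin k → Statistic} {C : Set (Set (S l))}
    (isClass : ∀ A ∈ C, ∃ τ, wilfClass st τ = A) (covers : ∀ τ, ∃ A ∈ C, τ ∈ A) :
    wilfClasses st l = C := by
  have subset : C ⊆ wilfClasses st l := fun A hA => by
    obtain ⟨τ, rfl⟩ := isClass A hA
    exact Setoid.mem_classes _ τ
  refine Set.Subset.antisymm (fun B hB => ?_) subset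
  obtain ⟨τ, rfl⟩ := hB
  obtain ⟨A, hA, hτ⟩ := covers τ
  have : A = {x | wilfSetoid st l x τ} :=
    Setoid.eq_of_mem_classes (subset hA) hτ (Setoid.mem_classes _ τ) ((wilfSetoid st l).refl τ)
  exact this ▸ hA

theorem wilfClass_nes : wilfClass ![nes] p123 = {p123} ∧ wilfClass ![nes] p321 = {p321} ∧
    wilfClass ![nes] p132 = {p132, p213} ∧ wilfClass ![nes] p231 = {p231, p312} := by
  simp only [wilfClass, wilfEquiv_nes_iff, Set.ext_iff, Set.mem_ofPred_eq, Set.mem_insert_iff,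
    Set.mem_singleton_iff]
  decide +kernel

theorem wilfClass_crs : wilfClass ![crs] p123 = {p123} ∧ wilfClass ![crs] p312 = {p312} ∧
    wilfClass ![crs] p231 = {p231} ∧ wilfClass ![crs] p132 = {p132, p213, p321} := by
  simp only [wilfClass, wilfEquiv_crs_iff, Set.ext_iff, Set.mem_ofPred_eq, Set.mem_insert_iff,
    Set.mem_singleton_iff]
  decide +kernel

theorem wilfClass_crs_nes : wilfClass ![crs, nes] p123 = {p123} ∧
    wilfClass ![crs, nes] p321 = {p321} ∧ wilfClass ![crs, nes] p312 = {p312} ∧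
    wilfClass ![crs, nes] p231 = {p231} ∧ wilfClass ![crs, nes] p132 = {p132, p213} := by
  simp only [wilfClass, wilfEquiv_crs_nes_iff, Set.ext_iff, Set.mem_ofPred_eq, Set.mem_insert_iff,
    Set.mem_singleton_iff]
  decide +kernel

theorem wilfClasses_nes :
    wilfClasses ![nes] 3 = {{p123}, {p321}, {p132, p213}, {p231, p312}} := by
  obtain ⟨h123, h321, h132, h231⟩ := wilfClass_nes
  refine wilfClasses_eq ?_ ?_
  · rintro _ (rfl | rfl | rfl | rfl)
    exacts [⟨_, h123⟩, ⟨_, h321⟩, ⟨_, h132⟩, ⟨_, h231⟩]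
  · simp only [Set.mem_insert_iff, Set.mem_singleton_iff, exists_eq_or_imp, exists_eq_left]
    decide

theorem wilfClasses_crs :
    wilfClasses ![crs] 3 = {{p123}, {p312}, {p231}, {p132, p213, p321}} := by
  obtain ⟨h123, h312, h231, h132⟩ := wilfClass_crs
  refine wilfClasses_eq ?_ ?_
  · rintro _ (rfl | rfl | rfl | rfl)
    exacts [⟨_, h123⟩, ⟨_, h312⟩, ⟨_, h231⟩, ⟨_, h132⟩]
  · simp only [Set.mem_insert_iff, Set.mem_singleton_iff, exists_eq_or_imp, exists_eq_left]
    decide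

theorem wilfClasses_crs_nes :
    wilfClasses ![crs, nes] 3 = {{p123}, {p321}, {p312}, {p231}, {p132, p213}} := by
  obtain ⟨h123, h321, h312, h231, h132⟩ := wilfClass_crs_nes
  refine wilfClasses_eq ?_ ?_
  · rintro _ (rfl | rfl | rfl | rfl | rfl)
    exacts [⟨_, h123⟩, ⟨_, h321⟩, ⟨_, h312⟩, ⟨_, h231⟩, ⟨_, h132⟩]
  · simp only [Set.mem_insert_iff, Set.mem_singleton_iff, exists_eq_or_imp, exists_eq_left]
    decide

end PermPattern

theorem theorem1 :
    -- the classes modulo nes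
    (wilfClasses ![nes] 3 = {{p123}, {p321}, {p132, p213}, {p231, p312}} ∧
      wilfClass ![nes] p132 = {p132, p213} ∧ wilfClass ![nes] p231 = {p231, p312}) ∧
    -- the classes modulo crs
    (wilfClasses ![crs] 3 = {{p123}, {p312}, {p231}, {p132, p213, p321}} ∧
      wilfClass ![crs] p132 = {p132, p213, p321}) ∧
    -- the classes modulo (crs, nes)
    (wilfClasses ![crs, nes] 3 = {{p123}, {p321}, {p312}, {p231}, {p132, p213}} ∧
      wilfClass ![crs, nes] p132 = {p132, p213}) := by
  obtain ⟨-, -, nes132, nes231⟩ := wilfClass_nes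
  obtain ⟨-, -, -, crs132⟩ := wilfClass_crs
  obtain ⟨-, -, -, -, both132⟩ := wilfClass_crs_nes
  exact ⟨⟨wilfClasses_nes, nes132, nes231⟩, ⟨wilfClasses_crs, crs132⟩,
    wilfClasses_crs_nes, both132⟩
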